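/- Let $R$ be a commutative noetherian ring. For a module $M$ let $E(M)$ be its injective hull, and let $\mho^0M=M$, $\mho^{i+1}M=E(\mho^iM)/\mho^iM$ be the cosyzygies in its minimal injective coresolution. For $Y\subseteq\operatorname{Spec}R$ let $\mathcal I(Y)=\operatorname{Add}\big(\bigoplus_{\mathfrak p\in Y}E(R/\mathfrak p)\big)$ be the class of all direct summands of direct sums of copies of $\bigoplus_{\mathfrak p\in Y}E(R/\mathfrak p)$. An $\mathcal I(Y)$-precover of $M$ is a map $f\colon D\to M$ with $D\in\mathcal I(Y)$ through which every map $D'\to M$ with $D'\in\mathcal I(Y)$ factors; it is a cover if moreover every $g\in\operatorname{End}_R(D)$ with $fg=f$ is an automorphism. Let $Y_0\subseteq Y_1\subseteq\cdots$ be subsets of $\operatorname{Spec}R$, each closed under generalization (if $\mathfrak q\in Y_i$ and $\mathfrak p\subseteq\mathfrak q$ then $\mathfrak p\in Y_i$), such that $\operatorname{Ass}(\mho^iR)\subseteq Y_i$ for all $i\ge 0$, and assume $Y_n=\operatorname{Spec}R$ for some $n\ge1$. For each $\mathfrak p\in\operatorname{Spec}R$ let $k$ be least with $\mathfrak p\in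 Y_k$, put $K_k=E(R/\mathfrak p)$, for $j=k-1,\dots,0$ choose an $\mathcal I(Y_j)$-precover $\Phi_j\colon E_j\to K_{j+1}$ and put $K_j=\operatorname{Ker}\Phi_j$; let $C_{\mathfrak p}=K_0$ (so $C_{\mathfrak p}=E(R/\mathfrak p)$ for $\mathfrak p\in Y_0$). Put $C=\prod_{\mathfrak p\in\operatorname{Spec}R}C_{\mathfrak p}$. Then such choices exist, and the precovers can even be taken to be covers. For every such choice of precovers (in particular for covers): 1. ${}^\perp C=\operatorname{Cog}_nC$, where ${}^\perp C=\{M\mid \operatorname{Ext}^i_R(M,C)=0\text{ for all }i\ge1\}$, and $\operatorname{Cog}_nC$ is the class of modules $M$ having an exact sequence $0\to M\to C_0\to C_1\to\cdots$ in which $C_i$ is a product of copies of $C$ for each $i<n$. 2. $C$ is an $n$-cotilting module, that is: $C$ has injective dimension at most $n$; $\operatorname{Ext}^i_R(C^\kappa,C)=0$ for all $i\ge1$ and all cardinals $\kappa$; and for some $r\ge 0$ there is an exact sequence $0\to C_r\to\cdots\to C_0\to W\to0$ where $W$ is an injective cogenerator and every $C_i$ is a direct summand of a direct product of copies of $C$.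 3. $C$ induces the class $\mathcal C(Y_0,\dots,Y_{n-1})$, that is, ${}^\perp C$ is the class of all modules $X$ such that for every $i\ge0$ the $i$-th term $E(\mho^iX)$ of the minimal injective coresolution of $X$ is of the form $\bigoplus_{\mathfrak p\in Y_i}E(R/\mathfrak p)^{(I_{\mathfrak p,i})}$ for some sets $I_{\mathfrak p,i}$. -/

import Mathlib

namespace CotiltConstr

open CategoryTheory
open scoped DirectSum

universe u

section Hull

variable {R : Type u} [CommRing R]

/-- `ι : M → E` is an injective hull: `E` is injective, `ι` is a monomorphism and its image is an
essential submodule of `E`. -/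
structure IsInjectiveHull {M E : ModuleCat.{u} R} (ι : M →ₗ[R] E) : Prop where
  injective_module : Module.Injective R E
  mono : Function.Injective ι
  essential : ∀ L : Submodule R E, Disjoint L (LinearMap.range ι) → L = ⊥

theorem exists_isInjectiveHull (M : ModuleCat.{u} R) :
    ∃ (E : ModuleCat.{u} R) (ι : M →ₗ[R] E), IsInjectiveHull ι := by
  obtain ⟨Q, hQ, j, hj⟩ : ∃ (Q : ModuleCat.{u} R) (_ : Module.Injective R Q) (j : M →ₗ[R] Q),
      Function.Injective j :=
    ⟨Injective.under M,
      (Module.injective_iff_injective_object R _).2 (Injective.injective_under M),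
      (Injective.ι M).hom,
      (ModuleCat.mono_iff_injective _).1 inferInstance⟩
  obtain ⟨N, hAN, hN⟩ := zorn_le_nonempty₀
    {N : Submodule R Q | LinearMap.range j ≤ N ∧
      ∀ L ≤ N, Disjoint L (LinearMap.range j) → L = ⊥}
    (by
      intro c hc hchain N₀ hN₀
      refine ⟨sSup c, ⟨(hc hN₀).1.trans (le_sSup hN₀), fun L hL hd => ?_⟩,
        fun z hz => le_sSup hz⟩
      rw [Submodule.eq_bot_iff]
      intro x hx
      obtain ⟨N', hN', hxN'⟩ :=
        (Submodule.mem_sSup_of_directed ⟨N₀, hN₀⟩ hchain.directedOn).1 (hL hx)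
      have hspan : Submodule.span R {x} = ⊥ :=
        (hc hN').2 _ ((Submodule.span_singleton_le_iff_mem _ _).2 hxN')
          (hd.mono_left ((Submodule.span_singleton_le_iff_mem _ _).2 hx))
      simpa using hspan)
    (LinearMap.range j) ⟨le_rfl, fun L hL hd => by
      rw [← hd.eq_bot, inf_eq_left.2 hL]⟩
  obtain ⟨K, -, hK⟩ := zorn_le_nonempty₀ {K : Submodule R Q | Disjoint K N}
    (by
      intro c hc hchain K₀ hK₀
      refine ⟨sSup c, ?_, fun z hz => le_sSup hz⟩
      refine Submodule.disjoint_def.2 ?_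
      intro x hx hxN
      obtain ⟨K', hK', hxK'⟩ :=
        (Submodule.mem_sSup_of_directed ⟨K₀, hK₀⟩ hchain.directedOn).1 hx
      exact Submodule.disjoint_def.1 (hc hK') x hxK' hxN)
    ⊥ disjoint_bot_left
  have hπ : Function.Injective (K.mkQ ∘ₗ N.subtype) := by
    rw [← LinearMap.ker_eq_bot, Submodule.eq_bot_iff]
    intro x hx
    have hxK : (x : Q) ∈ K := by simpa using hx
    exact Subtype.ext (Submodule.disjoint_def.1 hK.prop x hxK x.2)
  obtain ⟨g, hg⟩ := Module.Baer.extension_property (Module.Baer.of_injective hQ)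
    (K.mkQ ∘ₗ N.subtype) hπ N.subtype
  have hgN : ∀ x ∈ N, g (K.mkQ x) = x := fun x hx => LinearMap.congr_fun hg ⟨x, hx⟩
  have hrange : LinearMap.range g ≤ N := by
    refine hN.2 ⟨hAN.trans fun x hx => ⟨K.mkQ x, hgN x hx⟩, fun L hL hd => ?_⟩
      fun x hx => ⟨K.mkQ x, hgN x hx⟩
    have hLN : L ⊓ N = ⊥ := hN.prop.2 _ inf_le_right (hd.mono_left inf_le_left)
    have hle : L.comap (g ∘ₗ K.mkQ) ≤ K := by
      refine hK.2 ?_ fun x hx => ?_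
      · refine Submodule.disjoint_def.2 ?_
        intro x hx hxN
        have hxL : g (K.mkQ x) ∈ L := hx
        rw [hgN x hxN] at hxL
        have : x ∈ L ⊓ N := ⟨hxL, hxN⟩
        simpa [hLN] using this
      · have : K.mkQ x = 0 := by simpa using hx
        simp [Submodule.mem_comap, this]
    rw [Submodule.eq_bot_iff]
    intro y hy
    obtain ⟨z, rfl⟩ := hL hy
    obtain ⟨x, rfl⟩ := K.mkQ_surjective z
    have hxK : x ∈ K := hle hy
    have : K.mkQ x = 0 := by simpa using hxK
    rw [this, map_zero]
  refine ⟨ModuleCat.of R N, j.codRestrict N fun x => hAN ⟨x, rfl⟩, ?_, ?_, ?_⟩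
  · refine ⟨fun X Y _ _ _ _ f hf h => ?_⟩
    obtain ⟨h', hh'⟩ := hQ.out f hf (N.subtype ∘ₗ h)
    refine ⟨(g ∘ₗ K.mkQ ∘ₗ h').codRestrict N fun x => hrange ⟨_, rfl⟩, fun x => ?_⟩
    refine Subtype.ext ?_
    change g (K.mkQ (h' (f x))) = _
    rw [hh']
    exact hgN _ (h x).2
  · intro x y hxy
    exact hj (congrArg Subtype.val hxy)
  · intro L hL
    have h1 : L.map N.subtype = ⊥ := by
      refine hN.prop.2 _ (Submodule.map_subtype_le _ _) ?_
      rw [Submodule.disjoint_def]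
      rintro _ ⟨x, hx, rfl⟩ ⟨m, hm⟩
      have : x = 0 := Submodule.disjoint_def.1 hL x hx ⟨m, Subtype.ext hm⟩
      simp [this]
    rw [Submodule.eq_bot_iff]
    intro x hx
    have h2 : (x : Q) ∈ L.map N.subtype := ⟨x, hx, rfl⟩
    rw [h1, Submodule.mem_bot] at h2
    exact Subtype.ext h2

/-- The injective hull `E(M)`. -/
noncomputable def injectiveHull (M : ModuleCat.{u} R) : ModuleCat.{u} R :=
  (exists_isInjectiveHull M).choose

/-- The embedding `M → E(M)`. -/
noncomputable def hullMap (M : ModuleCat.{u} R) : M →ₗ[R] injectiveHull M :=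
  (exists_isInjectiveHull M).choose_spec.choose

theorem isInjectiveHull_hullMap (M : ModuleCat.{u} R) : IsInjectiveHull (hullMap M) :=
  (exists_isInjectiveHull M).choose_spec.choose_spec

/-- The `i`-th cosyzygy `℧ⁱ M` in the minimal injective coresolution
`0 → M → E(M) → E(℧¹ M) → E(℧² M) → ⋯`: `℧⁰ M = M` and `℧ⁱ⁺¹ M = E(℧ⁱ M) / ℧ⁱ M`. -/
noncomputable def cosyzygy (M : ModuleCat.{u} R) : ℕ → ModuleCat.{u} R
  | 0 => M
  | i + 1 => ModuleCat.of R (injectiveHull (cosyzygy M i) ⧸ LinearMap.range (hullMap (cosyzygy M i)))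

/-- `E(R/𝔭)`. -/
noncomputable def primeHull (p : PrimeSpectrum R) : ModuleCat.{u} R :=
  injectiveHull (ModuleCat.of R (R ⧸ p.asIdeal))

end Hull

section Classes

variable {R : Type u} [CommRing R]

/-- `N` is (isomorphic to) a direct summand of `M`. -/
def IsSummand (N M : ModuleCat.{u} R) : Prop :=
  ∃ (s : N →ₗ[R] M) (r : M →ₗ[R] N), r ∘ₗ s = LinearMap.id

/-- `Add M`: direct summands of direct sums of copies of `M`. -/
def addClass (M : ModuleCat.{u} R) : ObjectProperty (ModuleCat.{u} R) := fun N =>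
  ∃ I : Type u, IsSummand N (ModuleCat.of R (I →₀ M))

/-- `Prod M`: direct summands of direct products of copies of `M`. -/
def prodClass (M : ModuleCat.{u} R) : ObjectProperty (ModuleCat.{u} R) := fun N =>
  ∃ I : Type u, IsSummand N (ModuleCat.of R (I → M))

/-- `I(Y) = Add (⨁_{𝔭 ∈ Y} E(R/𝔭))`. -/
def injClass (Y : Set (PrimeSpectrum R)) : ObjectProperty (ModuleCat.{u} R) :=
  addClass (ModuleCat.of R (⨁ p : Y, primeHull p.1))

/-- `f : D → M` is a `P`-precover of `M`. -/
def IsPrecover (P : ObjectProperty (ModuleCat.{u} R)) {D M : ModuleCat.{u} R}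
    (f : D →ₗ[R] M) : Prop :=
  P D ∧ ∀ D' : ModuleCat.{u} R, P D' → ∀ f' : D' →ₗ[R] M, ∃ g : D' →ₗ[R] D, f' = f ∘ₗ g

/-- `f : D → M` is a `P`-cover of `M`. -/
def IsCover (P : ObjectProperty (ModuleCat.{u} R)) {D M : ModuleCat.{u} R}
    (f : D →ₗ[R] M) : Prop :=
  IsPrecover P f ∧ ∀ g : D →ₗ[R] D, f = f ∘ₗ g → Function.Bijective g

/-- `⊥C`: the modules `M` with `Extⁱ(M, C) = 0` for all `i ≥ 1`. -/
def leftPerp (C : ModuleCat.{u} R) : ObjectProperty (ModuleCat.{u} R) := fun M =>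
  ∀ i : ℕ, 1 ≤ i → Subsingleton (Abelian.Ext.{u} M C i)

/-- `Cog_n C`: the modules `M` that fit into a long exact sequence
`0 → M → C₀ → C₁ → ⋯` where `C_i` is a product of copies of `C` for each `i < n`. -/
def cogClass (n : ℕ) (C : ModuleCat.{u} R) : ObjectProperty (ModuleCat.{u} R) := fun M =>
  ∃ (D : ℕ → ModuleCat.{u} R) (ι : M →ₗ[R] D 0) (d : ∀ i, D i →ₗ[R] D (i + 1)),
    Function.Injective ι ∧ Function.Exact ι (d 0) ∧ (∀ i, Function.Exact (d i) (d (i + 1))) ∧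
    ∀ i < n, ∃ I : Type u, Nonempty (D i ≃ₗ[R] (I → C))

/-- Cotilting modules. In the third condition the exact sequence
`0 → C_r → ⋯ → C₀ → W → 0` is extended by zeros to the left. -/
structure IsCotilting (C : ModuleCat.{u} R) : Prop where
  finite_injDim : ∃ m : ℕ, HasInjectiveDimensionLE C m
  ext_pow : ∀ (κ : Type u) (i : ℕ), 1 ≤ i →
    Subsingleton (Abelian.Ext.{u} (ModuleCat.of R (κ → C)) C i)
  resolution : ∃ (W : ModuleCat.{u} R) (r : ℕ) (D : ℕ → ModuleCat.{u} R)
    (ε : D 0 →ₗ[R] W) (d : ∀ i, D (i + 1) →ₗ[R] D i),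
    Injective W ∧ IsCoseparator W ∧
    Function.Surjective ε ∧ Function.Exact (d 0) ε ∧ (∀ i, Function.Exact (d (i + 1)) (d i)) ∧
    (∀ i ≤ r, prodClass C (D i)) ∧ ∀ i, r < i → Subsingleton (D i)

/-- `n`-cotilting modules: cotilting modules of injective dimension at most `n`. -/
def IsNCotilting (n : ℕ) (C : ModuleCat.{u} R) : Prop :=
  IsCotilting C ∧ HasInjectiveDimensionLE C n

/-- `C(Y₀, Y₁, …)`: the modules `X` whose minimal injective coresolution has `i`-th term
`E(℧ⁱ X)` of the form `⨁_{𝔭 ∈ Y_i} E(R/𝔭)^(I_𝔭)` for each `i`. If `Y_i = Spec R` for all `i ≥ n`,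
this class is also written `C(Y₀, …, Y_{n-1})`. -/
def cotiltClass (Y : ℕ → Set (PrimeSpectrum R)) : ObjectProperty (ModuleCat.{u} R) := fun X =>
  ∀ i : ℕ, ∃ I : Y i → Type u,
    Nonempty (injectiveHull (cosyzygy X i) ≃ₗ[R] ⨁ p : Y i, (I p →₀ primeHull p.1))

end Classes

section Construction

variable {R : Type u} [CommRing R]

/-- The iterated precover construction for a prime `𝔭`. Let `k` be least with `𝔭 ∈ Y_k`. Starting
from `K_k = E(R/𝔭)`, for `j = k - 1, …, 0` one takes an `I(Y_j)`-precover `Φ_j : E_j → K_{j+1}`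
and its kernel `ν_j : K_j → E_j`. With `φ_j = ν_{j+1} Φ_j` these form the complex
`0 → K_0 → E_0 → ⋯ → E_{k-1} → E(R/𝔭) → 0`, and `C_𝔭 = K_0`; for `k = 0` this is
`C_𝔭 = E(R/𝔭)`. The entries with `j ≥ k` (`j > k` for `K`) play no role. -/
structure PrecoverComplex (Y : ℕ → Set (PrimeSpectrum R)) (p : PrimeSpectrum R) where
  k : ℕ
  isLeast_k : IsLeast {j | p ∈ Y j} k
  K : ℕ → ModuleCat.{u} R
  E : ℕ → ModuleCat.{u} R
  ν : ∀ j, K j →ₗ[R] E j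
  Φ : ∀ j, E j →ₗ[R] K (j + 1)
  top : K k ≃ₗ[R] primeHull p
  isPrecover : ∀ j < k, IsPrecover (injClass (Y j)) (Φ j)
  ν_injective : ∀ j < k, Function.Injective (ν j)
  ν_exact : ∀ j < k, Function.Exact (ν j) (Φ j)

namespace PrecoverComplex

variable {Y : ℕ → Set (PrimeSpectrum R)} {p : PrimeSpectrum R}

/-- All the precovers of the construction are covers. -/
def ByCovers (D : PrecoverComplex Y p) : Prop :=
  ∀ j < D.k, IsCover (injClass (Y j)) (D.Φ j)

/-- The module `C_𝔭` produced by the construction. -/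
def component (D : PrecoverComplex Y p) : ModuleCat.{u} R := D.K 0

end PrecoverComplex

/-- `C = ∏_𝔭 C_𝔭`. -/
def cotiltModule {Y : ℕ → Set (PrimeSpectrum R)} (D : ∀ p, PrecoverComplex Y p) :
    ModuleCat.{u} R :=
  ModuleCat.of R (∀ p, (D p).component)

end Construction

end CotiltConstr

/-!
Over a noetherian ring an injective module is a direct sum of hulls `E(R/𝔭)`, and the primes which
occur are read off from `Hom(R/𝔭, -)`. Shifting dimensions along the minimal injective coresolution,
`X` lies in `C(Y₀, Y₁, …)` iff `Extⁱ(R/𝔭, X) = 0` for all `i` and all `𝔭 ∉ Y_i`, a condition to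
which long exact sequences apply.

For a fixed prime, descending induction on `i` shows that the precover `E_i → K_{i+1}` is surjective
and that `Ext^{≥1}(X, K_i) = 0` for all `X` satisfying this condition for `Y_i, Y_{i+1}, …`: a map
`X → K_{i+1}` extends to `E(X)`, because `Ext¹(E(X)/X, K_{i+1}) = 0`, and then factors through the
precover, because `E(X)` lies in `I(Y_i)`. Taking `X = R` gives surjectivity. Hence
`C(Y₀, Y₁, …) ⊆ ⊥C`, and `C` itself lies in `C(Y₀, Y₁, …)`, so all powers of `C` lie in `⊥C`.

Conversely `C` cogenerates every `X` in `⊥C`: a map from `X` to some `E(R/𝔭)` which does not kill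
`x` lifts down along the precovers until it reaches a factor of `C`. So the canonical maps
`X → C^Hom(X, C)` are injective with cokernels in `⊥C`, and iterating them gives `⊥C ⊆ Cog_n C`,
while `Cog_n C ⊆ C(Y₀, Y₁, …)` by dimension shifting. Finally, an Auslander–Buchweitz approximation
of an injective cogenerator by a module in `⊥C` yields the resolution required for cotilting.
-/

namespace CotiltConstr

open CategoryTheory Abelian
open scoped DirectSum

section Ext

universe w v u

variable {𝒜 : Type u} [Category.{v} 𝒜] [Abelian 𝒜] [HasExt.{w} 𝒜]

theorem subsingleton_ext_of_retract {X A B : 𝒜} {i : ℕ} (h : Retract A B)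
    (hB : Subsingleton (Ext.{w} X B i)) : Subsingleton (Ext.{w} X A i) := by
  refine subsingleton_of_forall_eq 0 fun e => ?_
  calc e = (e.comp (Ext.mk₀ h.i) (add_zero i)).comp (Ext.mk₀ h.r) (add_zero i) := by
        rw [Ext.comp_assoc_of_third_deg_zero, Ext.mk₀_comp_mk₀, h.retract, Ext.comp_mk₀_id]
    _ = 0 := by rw [Subsingleton.elim (e.comp (Ext.mk₀ h.i) (add_zero i)) 0, Ext.zero_comp]

variable {S : ShortComplex 𝒜} (hS : S.ShortExact) {X : 𝒜} {i : ℕ}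

include hS

theorem subsingleton_ext_right_X₁ (h₃ : Subsingleton (Ext.{w} X S.X₃ i))
    (h₂ : Subsingleton (Ext.{w} X S.X₂ (i + 1))) : Subsingleton (Ext.{w} X S.X₁ (i + 1)) := by
  refine subsingleton_of_forall_eq 0 fun e => ?_
  obtain ⟨y, rfl⟩ := Ext.covariant_sequence_exact₁ X hS e (Subsingleton.elim _ _) rfl
  rw [Subsingleton.elim y 0, Ext.zero_comp]

theorem subsingleton_ext_right_X₂ (h₁ : Subsingleton (Ext.{w} X S.X₁ i))
    (h₃ : Subsingleton (Ext.{w} X S.X₃ i)) : Subsingleton (Ext.{w} X S.X₂ i) := by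
  refine subsingleton_of_forall_eq 0 fun e => ?_
  obtain ⟨y, rfl⟩ := Ext.covariant_sequence_exact₂ X hS e (Subsingleton.elim _ _)
  rw [Subsingleton.elim y 0, Ext.zero_comp]

theorem subsingleton_ext_right_X₃ (h₂ : Subsingleton (Ext.{w} X S.X₂ i))
    (h₁ : Subsingleton (Ext.{w} X S.X₁ (i + 1))) : Subsingleton (Ext.{w} X S.X₃ i) := by
  refine subsingleton_of_forall_eq 0 fun e => ?_
  obtain ⟨y, rfl⟩ := Ext.covariant_sequence_exact₃ X hS e rfl (Subsingleton.elim _ _)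
  rw [Subsingleton.elim y 0, Ext.zero_comp]

theorem subsingleton_ext_left_X₁ (h₂ : Subsingleton (Ext.{w} S.X₂ X i))
    (h₃ : Subsingleton (Ext.{w} S.X₃ X (i + 1))) : Subsingleton (Ext.{w} S.X₁ X i) := by
  refine subsingleton_of_forall_eq 0 fun e => ?_
  obtain ⟨y, rfl⟩ := Ext.contravariant_sequence_exact₁ hS X e (add_comm 1 i)
    (Subsingleton.elim _ _)
  rw [Subsingleton.elim y 0, Ext.comp_zero]

theorem subsingleton_ext_left_X₂ (h₁ : Subsingleton (Ext.{w} S.X₁ X i))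
    (h₃ : Subsingleton (Ext.{w} S.X₃ X i)) : Subsingleton (Ext.{w} S.X₂ X i) := by
  refine subsingleton_of_forall_eq 0 fun e => ?_
  obtain ⟨y, rfl⟩ := Ext.contravariant_sequence_exact₂ hS X e (Subsingleton.elim _ _)
  rw [Subsingleton.elim y 0, Ext.comp_zero]

theorem subsingleton_ext_left_X₃ (h₁ : Subsingleton (Ext.{w} S.X₁ X i))
    (h₂ : Subsingleton (Ext.{w} S.X₂ X (i + 1))) : Subsingleton (Ext.{w} S.X₃ X (i + 1)) := by
  refine subsingleton_of_forall_eq 0 fun e => ?_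
  obtain ⟨y, rfl⟩ := Ext.contravariant_sequence_exact₃ hS X e (Subsingleton.elim _ _)
    (add_comm 1 i)
  rw [Subsingleton.elim y 0, Ext.comp_zero]

theorem exists_comp_g_eq (h₁ : Subsingleton (Ext.{w} X S.X₁ 1)) (φ : X ⟶ S.X₃) :
    ∃ ψ : X ⟶ S.X₂, ψ ≫ S.g = φ := by
  obtain ⟨y, hy⟩ := Ext.covariant_sequence_exact₃ X hS (Ext.mk₀ φ) (zero_add 1)
    (Subsingleton.elim _ _)
  obtain ⟨ψ, rfl⟩ := Ext.homEquiv₀.symm.surjective y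
  rw [Ext.homEquiv₀_symm_apply, Ext.mk₀_comp_mk₀] at hy
  exact ⟨ψ, Ext.homEquiv₀.symm.injective hy⟩

theorem exists_f_comp_eq (h₃ : Subsingleton (Ext.{w} S.X₃ X 1)) (φ : S.X₁ ⟶ X) :
    ∃ ψ : S.X₂ ⟶ X, S.f ≫ ψ = φ := by
  obtain ⟨y, hy⟩ := Ext.contravariant_sequence_exact₁ hS X (Ext.mk₀ φ) (add_zero 1)
    (Subsingleton.elim _ _)
  obtain ⟨ψ, rfl⟩ := Ext.homEquiv₀.symm.surjective y
  rw [Ext.homEquiv₀_symm_apply, Ext.mk₀_comp_mk₀] at hy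
  exact ⟨ψ, Ext.homEquiv₀.symm.injective hy⟩

theorem subsingleton_ext_one_right_X₁ (h₂ : Subsingleton (Ext.{w} X S.X₂ 1))
    (hsurj : ∀ φ : X ⟶ S.X₃, ∃ ψ : X ⟶ S.X₂, ψ ≫ S.g = φ) :
    Subsingleton (Ext.{w} X S.X₁ 1) := by
  refine subsingleton_of_forall_eq 0 fun e => ?_
  obtain ⟨y, rfl⟩ := Ext.covariant_sequence_exact₁ X hS e (Subsingleton.elim _ _) (zero_add 1)
  obtain ⟨φ, rfl⟩ := Ext.homEquiv₀.symm.surjective y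
  obtain ⟨ψ, rfl⟩ := hsurj φ
  rw [Ext.homEquiv₀_symm_apply, ← Ext.mk₀_comp_mk₀, Ext.comp_assoc_of_second_deg_zero,
    hS.comp_extClass, Ext.comp_zero]

theorem subsingleton_ext_one_left_X₃ (h₂ : Subsingleton (Ext.{w} S.X₂ X 1))
    (hsurj : ∀ φ : S.X₁ ⟶ X, ∃ ψ : S.X₂ ⟶ X, S.f ≫ ψ = φ) :
    Subsingleton (Ext.{w} S.X₃ X 1) := by
  refine subsingleton_of_forall_eq 0 fun e => ?_
  obtain ⟨y, rfl⟩ := Ext.contravariant_sequence_exact₃ hS X e (Subsingleton.elim _ _) (add_zero 1)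
  obtain ⟨φ, rfl⟩ := Ext.homEquiv₀.symm.surjective y
  obtain ⟨ψ, rfl⟩ := hsurj φ
  rw [Ext.homEquiv₀_symm_apply, ← Ext.mk₀_comp_mk₀, hS.extClass_comp_assoc]

end Ext

universe u

section ShortExact

variable {R : Type u} [CommRing R] {A B C : ModuleCat.{u} R}

/-- Short exactness of `0 → A → B → C → 0`, for maps `f : A → B` and `g : B → C` that are not
bundled into a `ShortComplex`. -/
structure IsShortExact (f : A →ₗ[R] B) (g : B →ₗ[R] C) : Prop where
  injective : Function.Injective f
  exact : Function.Exact f g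
  surjective : Function.Surjective g

theorem isShortExact_ker {g : B →ₗ[R] C} (hg : Function.Surjective g) :
    IsShortExact (A := ModuleCat.of R (LinearMap.ker g)) (LinearMap.ker g).subtype g :=
  ⟨Subtype.val_injective, LinearMap.exact_subtype_ker_map g, hg⟩

theorem isShortExact_coker {f : A →ₗ[R] B} (hf : Function.Injective f) :
    IsShortExact (C := ModuleCat.of R (B ⧸ LinearMap.range f)) f (LinearMap.range f).mkQ :=
  ⟨hf, LinearMap.exact_map_mkQ_range f, Submodule.mkQ_surjective _⟩

namespace IsShortExact

variable {f : A →ₗ[R] B} {g : B →ₗ[R] C} (h : IsShortExact f g)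

/-- The short complex with maps `f` and `g`, to which the long exact sequences of `Ext` apply. -/
abbrev shortComplex : ShortComplex (ModuleCat.{u} R) :=
  ShortComplex.mk (ModuleCat.ofHom f) (ModuleCat.ofHom g)
    (ModuleCat.hom_ext h.exact.linearMap_comp_eq_zero)

include h

theorem shortExact : h.shortComplex.ShortExact :=
  ModuleCat.shortComplex_shortExact _ h.exact h.injective h.surjective

theorem exists_lift {X : ModuleCat.{u} R} (hA : Subsingleton (Ext.{u} X A 1)) (φ : X →ₗ[R] C) :
    ∃ ψ : X →ₗ[R] B, g ∘ₗ ψ = φ := by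
  obtain ⟨ψ, hψ⟩ := exists_comp_g_eq h.shortExact hA (ModuleCat.ofHom φ)
  exact ⟨ψ.hom, congrArg ModuleCat.Hom.hom hψ⟩

theorem exists_extend {X : ModuleCat.{u} R} (hC : Subsingleton (Ext.{u} C X 1)) (φ : A →ₗ[R] X) :
    ∃ ψ : B →ₗ[R] X, ψ ∘ₗ f = φ := by
  obtain ⟨ψ, hψ⟩ := exists_f_comp_eq h.shortExact hC (ModuleCat.ofHom φ)
  exact ⟨ψ.hom, congrArg ModuleCat.Hom.hom hψ⟩

end IsShortExact

end ShortExact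

section ExtModule

variable {R : Type u} [CommRing R] {X A B : ModuleCat.{u} R} {i : ℕ}

/-- `Extⁱ(X, A) = 0`. -/
abbrev ExtZero (X A : ModuleCat.{u} R) (i : ℕ) : Prop := Subsingleton (Ext.{u} X A i)

theorem extZero_zero_iff : ExtZero X A 0 ↔ ∀ f : X →ₗ[R] A, f = 0 := by
  rw [ExtZero, Ext.homEquiv₀.subsingleton_congr]
  exact ⟨fun h f => congrArg ModuleCat.Hom.hom (Subsingleton.elim (ModuleCat.ofHom f) 0),
    fun h => subsingleton_of_forall_eq 0 fun f => ModuleCat.hom_ext (h f.hom)⟩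

theorem extZero_of_injective (X : ModuleCat.{u} R) (hA : Module.Injective R A) (i : ℕ) :
    ExtZero X A (i + 1) :=
  have : Injective A := (Module.injective_iff_injective_object R A).1 hA
  Ext.subsingleton_of_injective X A i

theorem ExtZero.of_isSummand (h : ExtZero X B i) (hAB : IsSummand A B) : ExtZero X A i := by
  obtain ⟨s, r, hrs⟩ := hAB
  exact subsingleton_ext_of_retract
    ⟨ModuleCat.ofHom s, ModuleCat.ofHom r, ModuleCat.hom_ext hrs⟩ h

theorem exists_projective_presentation (X : ModuleCat.{u} R) :
    ∃ (N P : ModuleCat.{u} R) (f : N →ₗ[R] P) (g : P →ₗ[R] X), IsShortExact f g ∧ Projective P :=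
  ⟨_, ModuleCat.of R (X →₀ R), _, Finsupp.linearCombination R id,
    isShortExact_ker fun x => ⟨Finsupp.single x 1, by simp⟩,
    (IsProjective.iff_projective _).1 inferInstance⟩

-- Dimension shifting in the first variable reduces the claim to the universal property of `∏`.
theorem extZero_pi {ι : Type u} {A : ι → ModuleCat.{u} R} (h : ∀ j, ExtZero X (A j) i) :
    ExtZero X (ModuleCat.of R (∀ j, A j)) i := by
  induction i generalizing X with
  | zero =>
    refine extZero_zero_iff.2 fun f => LinearMap.ext fun x => funext fun j => ?_
    exact LinearMap.congr_fun (extZero_zero_iff.1 (h j) (LinearMap.proj j ∘ₗ f)) x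
  | succ i ih =>
    obtain ⟨N, P, f, g, hfg, hP⟩ := exists_projective_presentation X
    cases i with
    | zero =>
      refine subsingleton_ext_one_left_X₃ hfg.shortExact
        (Ext.subsingleton_of_projective _ _ _) fun φ => ?_
      choose ψ hψ using fun j => hfg.exists_extend (h j) (LinearMap.proj j ∘ₗ φ.hom)
      exact ⟨ModuleCat.ofHom (LinearMap.pi ψ), ModuleCat.hom_ext <| LinearMap.ext fun x =>
        funext fun j => LinearMap.congr_fun (hψ j) x⟩
    | succ i =>
      exact subsingleton_ext_left_X₃ hfg.shortExact
        (ih fun j => subsingleton_ext_left_X₁ hfg.shortExact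
          (Ext.subsingleton_of_projective _ _ _) (h j))
        (Ext.subsingleton_of_projective _ _ _)

theorem hasInjectiveDimensionLT_pi {ι : Type u} {A : ι → ModuleCat.{u} R} {n : ℕ}
    (h : ∀ j, HasInjectiveDimensionLT (A j) n) :
    HasInjectiveDimensionLT (ModuleCat.of R (∀ j, A j)) n :=
  HasInjectiveDimensionLT.mk fun i hi X e =>
    have : ExtZero X (ModuleCat.of R (∀ j, A j)) i :=
      extZero_pi fun j => (h j).subsingleton _ n i hi X
    Subsingleton.elim e 0

end ExtModule

section Injective

variable {R : Type u} [CommRing R] {N M E : Type u} [AddCommGroup N] [Module R N]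
  [AddCommGroup M] [Module R M] [AddCommGroup E] [Module R E]

theorem injective_of_leftInverse (hM : Module.Injective R M) {s : N →ₗ[R] M} {r : M →ₗ[R] N}
    (h : r ∘ₗ s = LinearMap.id) : Module.Injective R N := by
  refine ⟨fun X Y _ _ _ _ f hf φ => ?_⟩
  obtain ⟨ψ, hψ⟩ := hM.out f hf (s ∘ₗ φ)
  exact ⟨r ∘ₗ ψ, fun x => (congrArg r (hψ x)).trans (LinearMap.congr_fun h (φ x))⟩

theorem injective_of_equiv (e : M ≃ₗ[R] N) (hM : Module.Injective R M) : Module.Injective R N :=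
  ((Module.Baer.of_injective hM).of_equiv e).injective

theorem injective_range (hM : Module.Injective R M) {f : M →ₗ[R] E} (hf : Function.Injective f) :
    Module.Injective R (LinearMap.range f) :=
  injective_of_equiv (LinearEquiv.ofInjective f hf) hM

theorem injective_of_isCompl (hE : Module.Injective R E) {L L' : Submodule R E}
    (h : IsCompl L L') : Module.Injective R L :=
  injective_of_leftInverse hE (r := L.projectionOnto L' h) (s := L.subtype)
    (LinearMap.ext fun x => by simp)

theorem exists_isCompl_of_injective (L : Submodule R E) (hL : Module.Injective R L) :
    ∃ L' : Submodule R E, IsCompl L L' := by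
  obtain ⟨r, hr⟩ := hL.out L.subtype L.injective_subtype LinearMap.id
  exact ⟨_, LinearMap.isCompl_of_proj (f := r) hr⟩

theorem injective_prod (hN : Module.Injective R N) (hM : Module.Injective R M) :
    Module.Injective R (N × M) := by
  refine ⟨fun X Y _ _ _ _ f hf φ => ?_⟩
  obtain ⟨g, hg⟩ := hN.out f hf (LinearMap.fst R N M ∘ₗ φ)
  obtain ⟨h, hh⟩ := hM.out f hf (LinearMap.snd R N M ∘ₗ φ)
  exact ⟨g.prod h, fun x => Prod.ext (hg x) (hh x)⟩

theorem injective_sup_of_disjoint {L L' : Submodule R E} (hL : Module.Injective R L)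
    (hL' : Module.Injective R L') (h : Disjoint L L') : Module.Injective R ↥(L ⊔ L') := by
  rw [Submodule.sup_eq_range]
  refine injective_range (injective_prod hL hL') (LinearMap.ker_eq_bot.1 ?_)
  rw [LinearMap.ker_coprod_of_disjoint_range _ _ (by simpa using h), Submodule.ker_subtype,
    Submodule.ker_subtype, Submodule.prod_bot]

end Injective

section Summand

variable {R : Type u} [CommRing R] {N M L : ModuleCat.{u} R}

theorem isSummand_of_equiv (e : N ≃ₗ[R] M) : IsSummand N M :=
  ⟨e, e.symm, LinearMap.ext e.symm_apply_apply⟩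

theorem IsSummand.trans (h₁ : IsSummand N M) (h₂ : IsSummand M L) : IsSummand N L := by
  obtain ⟨s, r, h⟩ := h₁
  obtain ⟨s', r', h'⟩ := h₂
  refine ⟨s' ∘ₗ s, r ∘ₗ r', ?_⟩
  rw [LinearMap.comp_assoc, ← LinearMap.comp_assoc s, h', LinearMap.id_comp, h]

theorem isSummand_of_isCompl {K K' : Submodule R M} (h : IsCompl K K') :
    IsSummand (ModuleCat.of R K) M :=
  ⟨K.subtype, K.projectionOnto K' h, LinearMap.ext fun x => by simp⟩

theorem IsShortExact.isSummand_middle {A B C : ModuleCat.{u} R} {f : A →ₗ[R] B} {g : B →ₗ[R] C}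
    (h : IsShortExact f g) (hC : ExtZero C A 1) : IsSummand A B := by
  obtain ⟨r, hr⟩ := h.exists_extend hC LinearMap.id
  exact ⟨f, r, hr⟩

end Summand

section Hull

variable {R : Type u} [CommRing R]

namespace IsInjectiveHull

variable {M E : ModuleCat.{u} R} {ι : M →ₗ[R] E} (h : IsInjectiveHull ι)

include h

theorem injective_of_comp {N : Type u} [AddCommGroup N] [Module R N] {φ : E →ₗ[R] N}
    (hφ : Function.Injective (φ ∘ₗ ι)) : Function.Injective φ := by
  refine LinearMap.ker_eq_bot.1 (h.essential _ (Submodule.disjoint_def.2 ?_))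
  rintro _ hx ⟨m, rfl⟩
  rw [(map_eq_zero_iff _ hφ).1 hx, map_zero]

theorem exists_smul {x : E} (hx : x ≠ 0) : ∃ (a : R) (m : M), m ≠ 0 ∧ ι m = a • x := by
  by_contra! hne
  refine hx (Submodule.span_singleton_eq_bot.1 (h.essential _ (Submodule.disjoint_def.2 ?_)))
  rintro _ hy ⟨m, rfl⟩
  obtain ⟨a, ha⟩ := Submodule.mem_span_singleton.1 hy
  by_contra hm
  exact hne a m (by rintro rfl; exact hm (map_zero ι)) ha.symm

end IsInjectiveHull

theorem injective_primeHull (p : PrimeSpectrum R) : Module.Injective R (primeHull p) :=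
  (isInjectiveHull_hullMap _).injective_module

instance (p : PrimeSpectrum R) : Nontrivial (primeHull p) :=
  (isInjectiveHull_hullMap (ModuleCat.of R (R ⧸ p.asIdeal))).mono.nontrivial

end Hull

section Noetherian

theorem exists_finset_apply_eq_zero {R I : Type*} [CommRing R] [AddCommGroup I] [Module R I]
    [Module.Finite R I] {ι : Type*} {M : ι → Type*} [∀ i, AddCommGroup (M i)]
    [∀ i, Module R (M i)] (φ : I →ₗ[R] ⨁ i, M i) :
    ∃ S : Finset ι, ∀ x, ∀ i ∉ S, φ x i = 0 := by
  classical
  obtain ⟨T, hT⟩ : (⊤ : Submodule R I).FG := Module.Finite.fg_top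
  refine ⟨T.biUnion fun x => (φ x).support, fun x i hi => ?_⟩
  have hle : Submodule.span R T ≤ LinearMap.ker (DirectSum.component R ι M i ∘ₗ φ) := by
    refine Submodule.span_le.2 fun y hy => ?_
    simp only [Finset.mem_biUnion, not_exists, not_and, DFinsupp.notMem_support_iff] at hi
    exact hi y hy
  exact hle (hT ▸ Submodule.mem_top (x := x))

variable {R : Type u} [CommRing R] [IsNoetherianRing R] {E : Type u} [AddCommGroup E] [Module R E]

theorem injective_sSup_of_directedOn {c : Set (Submodule R E)} (hne : c.Nonempty)
    (hdir : DirectedOn (· ≤ ·) c) (hc : ∀ N ∈ c, Module.Injective R N) :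
    Module.Injective R (sSup c : Submodule R E) := by
  refine Module.Baer.injective fun I φ => ?_
  obtain ⟨N, hN, hle⟩ : ∃ N ∈ c, LinearMap.range ((sSup c).subtype ∘ₗ φ) ≤ N := by
    have hfg : (LinearMap.range ((sSup c).subtype ∘ₗ φ)).FG :=
      Module.Finite.iff_fg.1 inferInstance
    refine (CompleteLattice.isCompactElement_iff_le_of_directed_sSup_le _ _).1
      ((Submodule.fg_iff_compact _).1 hfg) c hne hdir ?_
    rintro _ ⟨x, rfl⟩
    exact (φ x).2
  obtain ⟨ψ, hψ⟩ := Module.Baer.of_injective (hc N hN) I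
    (((sSup c).subtype ∘ₗ φ).codRestrict N fun x => hle ⟨x, rfl⟩)
  exact ⟨Submodule.inclusion (le_sSup hN) ∘ₗ ψ, fun x hx =>
    Subtype.ext (congrArg (Subtype.val : N → E) (hψ x hx))⟩

theorem injective_directSum {ι : Type u} {M : ι → Type u} [∀ i, AddCommGroup (M i)]
    [∀ i, Module R (M i)] (hM : ∀ i, Module.Injective R (M i)) :
    Module.Injective R (⨁ i, M i) := by
  classical
  refine Module.Baer.injective fun I φ => ?_
  obtain ⟨S, hS⟩ := exists_finset_apply_eq_zero φ
  choose ψ hψ using fun i => Module.Baer.of_injective (hM i) I (DirectSum.component R ι M i ∘ₗ φ)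
  refine ⟨LinearMap.toSpanSingleton R _ (DFinsupp.mk S fun i => ψ i 1), fun x hx => ?_⟩
  ext i
  by_cases hi : i ∈ S
  · calc (x • (DFinsupp.mk S fun i => ψ i 1 : ⨁ i, M i)) i = x • ψ i 1 := by
          rw [DirectSum.smul_apply, DFinsupp.mk_of_mem hi]
      _ = φ ⟨x, hx⟩ i := by rw [← map_smul, smul_eq_mul, mul_one]; exact hψ i x hx
  · calc (x • (DFinsupp.mk S fun i => ψ i 1 : ⨁ i, M i)) i = 0 := by
          rw [DirectSum.smul_apply, DFinsupp.mk_of_notMem hi, smul_zero]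
      _ = φ ⟨x, hx⟩ i := (hS _ i hi).symm

theorem injective_finsupp (ι : Type u) (hE : Module.Injective R E) :
    Module.Injective R (ι →₀ E) := by
  classical
  exact injective_of_equiv (finsuppLEquivDirectSum R E ι).symm (injective_directSum fun _ => hE)

theorem injective_sSup_of_sSupIndep {T : Set (Submodule R E)} (hT : sSupIndep T)
    (h : ∀ N ∈ T, Module.Injective R N) : Module.Injective R (sSup T : Submodule R E) := by
  classical
  rw [sSup_eq_iSup', Submodule.iSup_eq_range_dfinsupp_lsum]
  exact injective_range (M := ⨁ N : T, (N : Submodule R E))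
    (injective_directSum fun N => h N N.2) ((sSupIndep_iff T).1 hT).dfinsupp_lsum_injective

end Noetherian

section HomZero

variable {R : Type u} [CommRing R]

/-- `Hom(R/𝔭, M) = 0` for every prime `𝔭 ∉ Y`, expressed by elements: no nonzero element of `M` is
annihilated by a prime outside `Y`. If `Y` is closed under generalization and `R` is noetherian,
this says that `Ass M ⊆ Y`. -/
def HomZero (Y : Set (PrimeSpectrum R)) (M : Type u) [AddCommGroup M] [Module R M] : Prop :=
  ∀ p ∉ Y, ∀ x : M, (∀ a ∈ p.asIdeal, a • x = 0) → x = 0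

variable {Y : Set (PrimeSpectrum R)} {M N : Type u} [AddCommGroup M] [Module R M]
  [AddCommGroup N] [Module R N] {ι : Type u}

theorem HomZero.of_injective (h : HomZero Y N) {f : M →ₗ[R] N} (hf : Function.Injective f) :
    HomZero Y M := fun p hp x hx =>
  (map_eq_zero_iff f hf).1 (h p hp _ fun a ha => by rw [← map_smul, hx a ha, map_zero])

theorem homZero_pi {M : ι → Type u} [∀ i, AddCommGroup (M i)] [∀ i, Module R (M i)]
    (h : ∀ i, HomZero Y (M i)) : HomZero Y (∀ i, M i) := fun p hp _ hx =>
  funext fun i => h i p hp _ fun a ha => congrFun (hx a ha) i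

theorem homZero_directSum {M : ι → Type u} [∀ i, AddCommGroup (M i)] [∀ i, Module R (M i)]
    (h : ∀ i, HomZero Y (M i)) : HomZero Y (⨁ i, M i) :=
  (homZero_pi h).of_injective (f := DFinsupp.coeFnLinearMap R) DFunLike.coe_injective

theorem homZero_finsupp (ι : Type u) (h : HomZero Y M) : HomZero Y (ι →₀ M) :=
  (homZero_pi fun _ : ι => h).of_injective (f := Finsupp.lcoeFun) DFunLike.coe_injective

theorem IsInjectiveHull.homZero {M E : ModuleCat.{u} R} {ι : M →ₗ[R] E} (h : IsInjectiveHull ι)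
    (hM : HomZero Y M) : HomZero Y E := by
  intro p hp x hx
  by_contra hne
  obtain ⟨a, m, hm, ham⟩ := h.exists_smul hne
  refine hm (hM p hp m fun b hb => h.mono ?_)
  rw [map_smul, ham, smul_comm, hx b hb, smul_zero, map_zero]

theorem homZero_primeHull (hY : IsLowerSet Y) {p : PrimeSpectrum R} (hp : p ∈ Y) :
    HomZero Y (primeHull p) := by
  refine (isInjectiveHull_hullMap _).homZero fun q hq x hx => ?_
  obtain ⟨r, rfl⟩ := Ideal.Quotient.mk_surjective x
  obtain ⟨a, haq, hap⟩ := Set.not_subset.1 fun h : q.asIdeal ≤ p.asIdeal => hq (hY h hp)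
  have har : Ideal.Quotient.mk p.asIdeal (a * r) = 0 := hx a haq
  rw [Ideal.Quotient.eq_zero_iff_mem] at har ⊢
  exact (p.isPrime.mem_or_mem har).resolve_left hap

theorem extZero_zero_quotient_iff {I : Ideal R} {M : ModuleCat.{u} R} :
    ExtZero (ModuleCat.of R (R ⧸ I)) M 0 ↔ ∀ x : M, (∀ a ∈ I, a • x = 0) → x = 0 := by
  rw [extZero_zero_iff]
  constructor
  · intro h x hx
    have hx' : I ≤ LinearMap.ker (LinearMap.toSpanSingleton R M x) := fun a ha => hx a ha
    have h1 := LinearMap.congr_fun (h (I.liftQ _ hx')) (Submodule.Quotient.mk 1)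
    rwa [Submodule.liftQ_apply, LinearMap.toSpanSingleton_apply, one_smul] at h1
  · intro h f
    have hf : f (Submodule.Quotient.mk 1) = 0 := by
      refine h _ fun a ha => ?_
      rw [← map_smul, ← Submodule.Quotient.mk_smul, (Submodule.Quotient.mk_eq_zero I).2, map_zero]
      simpa using ha
    exact Submodule.linearMap_qext _ (LinearMap.ext_ring hf)

theorem homZero_iff_extZero_zero {M : ModuleCat.{u} R} :
    HomZero Y M ↔ ∀ p ∉ Y, ExtZero (ModuleCat.of R (R ⧸ p.asIdeal)) M 0 :=
  forall₂_congr fun _ _ => extZero_zero_quotient_iff.symm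

theorem homZero_of_associatedPrimes [IsNoetherianRing R] (hY : IsLowerSet Y)
    (h : ∀ p : PrimeSpectrum R, p.asIdeal ∈ associatedPrimes R M → p ∈ Y) : HomZero Y M := by
  intro q hq x hx
  by_contra hne
  obtain ⟨P, hP, hle⟩ := exists_le_isAssociatedPrime_of_isNoetherianRing R x hne
  have hqP : q ≤ (⟨P, hP.1⟩ : PrimeSpectrum R) := fun a ha =>
    hle (Submodule.mem_colon_singleton.2 (hx a ha))
  exact hq (hY hqP (h ⟨P, hP.1⟩ hP))

end HomZero

section Matlis

theorem sSupIndep_insert {α : Type*} [CompleteLattice α] [IsModularLattice α] {T : Set α} {a : α}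
    (hT : sSupIndep T) (ha : Disjoint a (sSup T)) : sSupIndep (insert a T) := by
  rintro b (rfl | hb)
  · exact ha.mono_right (sSup_le fun c hc => le_sSup (hc.1.resolve_left hc.2))
  · have hbT : b ⊔ sSup (T \ {b}) ≤ sSup T := sup_le (le_sSup hb) (sSup_le_sSup Set.sdiff_subset)
    refine ((hT hb).disjoint_sup_right_of_disjoint_sup_left (ha.symm.mono_left hbT)).mono_right ?_
    refine sSup_le ?_
    rintro c ⟨rfl | hc, hcb⟩
    · exact le_sup_right
    · exact le_sup_of_le_left (le_sSup ⟨hc, hcb⟩)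

variable {R : Type u} [CommRing R] [IsNoetherianRing R] {Y : Set (PrimeSpectrum R)}
  {E : Type u} [AddCommGroup E] [Module R E]

theorem exists_sSupIndep_sSup_eq_top (hE : Module.Injective R E) {P : Set (Submodule R E)}
    (hP : ∀ N ∈ P, Module.Injective R N)
    (hex : ∀ N : Submodule R E, Module.Injective R N → N ≠ ⊥ → ∃ L ∈ P, L ≤ N ∧ L ≠ ⊥) :
    ∃ T ⊆ P, sSupIndep T ∧ sSup T = ⊤ := by
  obtain ⟨T, hT⟩ := zorn_subset {T : Set (Submodule R E) | T ⊆ P ∧ sSupIndep T}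
    fun c hc hchain => ⟨⋃₀ c, ⟨Set.sUnion_subset fun s hs => (hc hs).1,
      iSupIndep_sUnion_of_directed hchain.directedOn fun s hs => (hc hs).2⟩,
      fun s hs => Set.subset_sUnion_of_mem hs⟩
  obtain ⟨hTP, hind⟩ := hT.prop
  obtain ⟨N, hN⟩ := exists_isCompl_of_injective _
    (injective_sSup_of_sSupIndep hind fun N hN => hP N (hTP hN))
  refine ⟨T, hTP, hind, ?_⟩
  by_contra hne
  obtain ⟨L, hL, hLN, hL0⟩ := hex N (injective_of_isCompl hE hN.symm) fun h => hne <| by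
    simpa [h] using hN.sup_eq_top
  have hLT : L ∈ T := hT.2 ⟨Set.insert_subset hL hTP,
    sSupIndep_insert hind (hN.symm.disjoint.mono_left hLN)⟩ (Set.subset_insert L T)
    (Set.mem_insert L T)
  exact hL0 (le_bot_iff.1 (hN.disjoint (le_sSup hLT) hLN))

theorem exists_primeHull_embedding (hE : Module.Injective R E) (hY : HomZero Y E) [Nontrivial E] :
    ∃ p ∈ Y, ∃ f : primeHull p →ₗ[R] E, Function.Injective f := by
  obtain ⟨P, hP⟩ := associatedPrimes.nonempty R E
  obtain ⟨f, hf⟩ := ((isAssociatedPrime_iff_exists_injective_linearMap _ _).1 hP).2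
  let p : PrimeSpectrum R := ⟨P, hP.1⟩
  have hull := isInjectiveHull_hullMap (ModuleCat.of R (R ⧸ p.asIdeal))
  obtain ⟨g, hg⟩ := hE.out _ hull.mono f
  have hp : p ∈ Y := by
    by_contra hp
    have h1 : (1 : R ⧸ P) = 0 := hY.of_injective hf p hp 1 fun a ha => by
      rw [Algebra.smul_def, mul_one]
      exact Ideal.Quotient.eq_zero_iff_mem.2 ha
    have : P.IsPrime := hP.1
    exact one_ne_zero h1
  refine ⟨p, hp, g, hull.injective_of_comp ?_⟩
  rwa [show g ∘ₗ hullMap _ = f from LinearMap.ext hg]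

theorem exists_primeHull_decomposition (hE : Module.Injective R E) (hY : HomZero Y E) :
    ∃ (ι : Type u) (p : ι → Y), Nonempty (E ≃ₗ[R] ⨁ i, primeHull (p i).1) := by
  classical
  obtain ⟨T, hT, hind, htop⟩ := exists_sSupIndep_sSup_eq_top hE
    (P := {N | ∃ p : Y, Nonempty (primeHull p.1 ≃ₗ[R] N)})
    (fun N ⟨p, ⟨e⟩⟩ => injective_of_equiv e (injective_primeHull p.1))
    fun N hN hN0 => by
      have : Nontrivial N := Submodule.nontrivial_iff_ne_bot.2 hN0
      obtain ⟨p, hp, f, hf⟩ := exists_primeHull_embedding hN (hY.of_injective N.injective_subtype)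
      have e := LinearEquiv.ofInjective (N.subtype ∘ₗ f) (N.injective_subtype.comp hf)
      exact ⟨_, ⟨⟨p, hp⟩, ⟨e⟩⟩, LinearMap.range_comp_le_range f N.subtype |>.trans_eq
        N.range_subtype, Submodule.nontrivial_iff_ne_bot.1 e.symm.toEquiv.nontrivial⟩
  choose p e using fun N : T => hT N.2
  have hint : DirectSum.IsInternal fun N : T => (N : Submodule R E) :=
    DirectSum.isInternal_submodule_of_iSupIndep_of_iSup_eq_top ((sSupIndep_iff T).1 hind)
      (by rw [← sSup_eq_iSup', htop])
  exact ⟨T, p, ⟨(LinearEquiv.ofBijective (DirectSum.coeLinearMap _) hint).symm.trans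
    (DFinsupp.mapRange.linearEquiv fun N => (e N).some.symm)⟩⟩

end Matlis

section InjClass

variable {R : Type u} [CommRing R] {Y : Set (PrimeSpectrum R)}

theorem injClass_of_isSummand {N M : ModuleCat.{u} R} (h : IsSummand N M) (hM : injClass Y M) :
    injClass Y N :=
  hM.imp fun _ hI => h.trans hI

theorem injClass_directSum {ι : Type u} (p : ι → Y) :
    injClass Y (ModuleCat.of R (⨁ i, primeHull (p i).1)) := by
  classical
  refine ⟨ι,
    DirectSum.toModule R ι _ fun i => Finsupp.lsingle i ∘ₗ
      DirectSum.lof R Y (fun q => primeHull q.1) (p i),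
    Finsupp.lsum R fun i => DirectSum.lof R ι (fun i => primeHull (p i).1) i ∘ₗ
      DirectSum.component R Y (fun q => primeHull q.1) (p i), ?_⟩
  refine DirectSum.linearMap_ext _ fun i => LinearMap.ext fun x => ?_
  simp [DirectSum.component.lof_self]

theorem exists_injClass_precover (Y : Set (PrimeSpectrum R)) (M : ModuleCat.{u} R) :
    ∃ (D : ModuleCat.{u} R) (f : D →ₗ[R] M), IsPrecover (injClass Y) f := by
  classical
  let ι := Σ p : Y, primeHull p.1 →ₗ[R] M
  refine ⟨_, DirectSum.toModule R ι M fun i => i.2, injClass_directSum fun i : ι => i.1, ?_⟩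
  rintro D' ⟨I, s, r, hrs⟩ f'
  let φ : (I →₀ ⨁ p : Y, primeHull p.1) →ₗ[R] ⨁ i : ι, primeHull i.1.1 :=
    Finsupp.lsum R fun i => DirectSum.toModule R Y _ fun p =>
      DirectSum.lof R ι (fun i => primeHull i.1.1)
        ⟨p, f' ∘ₗ r ∘ₗ Finsupp.lsingle i ∘ₗ DirectSum.lof R Y (fun q => primeHull q.1) p⟩
  have hφ : DirectSum.toModule R ι M (fun i => i.2) ∘ₗ φ = f' ∘ₗ r := by
    refine Finsupp.lhom_ext' fun i => DirectSum.linearMap_ext _ fun p => LinearMap.ext fun x => ?_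
    simp [φ]
  refine ⟨φ ∘ₗ s, ?_⟩
  rw [← LinearMap.comp_assoc, hφ, LinearMap.comp_assoc, hrs, LinearMap.comp_id]

theorem exists_map_primeHull_ne_zero {D : ModuleCat.{u} R} (hD : injClass Y D) {x : D}
    (hx : x ≠ 0) : ∃ p ∈ Y, ∃ φ : D →ₗ[R] primeHull p, φ x ≠ 0 := by
  classical
  obtain ⟨I, s, r, hrs⟩ := hD
  by_contra! h
  have hs : s x = 0 := Finsupp.ext fun i => DFinsupp.ext fun p =>
    h p.1 p.2 (DirectSum.component R Y (fun q => primeHull q.1) p ∘ₗ Finsupp.lapply i ∘ₗ s)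
  exact hx (by rw [← LinearMap.id_apply (R := R) x, ← hrs, LinearMap.comp_apply, hs, map_zero])

theorem nonempty_directSum_linearEquiv_fiber {ι κ : Type u} (p : ι → κ) (M : κ → Type u)
    [∀ q, AddCommGroup (M q)] [∀ q, Module R (M q)] :
    Nonempty ((⨁ i, M (p i)) ≃ₗ[R] ⨁ q, ({i // p i = q} →₀ M q)) := by
  classical
  let F : (⨁ i, M (p i)) →ₗ[R] ⨁ q, ({i // p i = q} →₀ M q) :=
    DirectSum.toModule R ι _ fun i =>
      DirectSum.lof R κ (fun q => {i // p i = q} →₀ M q) (p i) ∘ₗ Finsupp.lsingle ⟨i, rfl⟩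
  let G : (⨁ q, ({i // p i = q} →₀ M q)) →ₗ[R] ⨁ i, M (p i) :=
    DirectSum.toModule R κ _ fun q => Finsupp.lsum R fun i : {i // p i = q} =>
      i.2 ▸ DirectSum.lof R ι (fun i => M (p i)) i.1
  have hFG : F ∘ₗ G = LinearMap.id := by
    refine DirectSum.linearMap_ext _ fun q => Finsupp.lhom_ext' ?_
    rintro ⟨i, rfl⟩
    exact LinearMap.ext fun x => by simp [F, G]
  have hGF : G ∘ₗ F = LinearMap.id :=
    DirectSum.linearMap_ext _ fun i => LinearMap.ext fun x => by simp [F, G]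
  exact ⟨LinearEquiv.ofLinearMap F G hFG hGF⟩

variable [IsNoetherianRing R]

theorem injective_of_injClass {D : ModuleCat.{u} R} (h : injClass Y D) : Module.Injective R D := by
  obtain ⟨I, s, r, hrs⟩ := h
  exact injective_of_leftInverse
    (injective_finsupp I (injective_directSum fun p : Y => injective_primeHull p.1)) hrs

theorem injClass_iff (hY : IsLowerSet Y) {D : ModuleCat.{u} R} :
    injClass Y D ↔ Module.Injective R D ∧ HomZero Y D := by
  refine ⟨fun h => ⟨injective_of_injClass h, ?_⟩, fun ⟨hinj, hzero⟩ => ?_⟩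
  · obtain ⟨I, s, r, hrs⟩ := h
    exact (homZero_finsupp I (homZero_directSum fun p : Y => homZero_primeHull hY p.2)).of_injective
      (f := s) (Function.LeftInverse.injective (LinearMap.congr_fun hrs))
  · obtain ⟨ι, p, ⟨e⟩⟩ := exists_primeHull_decomposition hinj hzero
    exact injClass_of_isSummand (isSummand_of_equiv e) (injClass_directSum p)

theorem homZero_iff_exists_equiv (hY : IsLowerSet Y) {E : Type u} [AddCommGroup E] [Module R E]
    (hE : Module.Injective R E) :
    HomZero Y E ↔ ∃ I : Y → Type u, Nonempty (E ≃ₗ[R] ⨁ p : Y, (I p →₀ primeHull p.1)) := by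
  constructor
  · intro h
    obtain ⟨ι, p, ⟨e⟩⟩ := exists_primeHull_decomposition hE h
    obtain ⟨e'⟩ := nonempty_directSum_linearEquiv_fiber (R := R) p fun q => primeHull q.1
    exact ⟨_, ⟨e.trans e'⟩⟩
  · rintro ⟨I, ⟨e⟩⟩
    have h : HomZero Y (⨁ p : Y, (I p →₀ primeHull p.1)) :=
      homZero_directSum fun p : Y => homZero_finsupp (I p) (homZero_primeHull hY p.2)
    exact h.of_injective (f := e.toLinearMap) e.injective

end InjClass

section Cover

variable {R : Type u} [CommRing R]

/-- `N` is an essential submodule: it meets every nonzero submodule. -/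
def IsEssential {E : Type u} [AddCommGroup E] [Module R E] (N : Submodule R E) : Prop :=
  ∀ L : Submodule R E, Disjoint L N → L = ⊥

theorem isEssential_ker_of_comp_eq_zero {E D M : Type u} [AddCommGroup E] [Module R E]
    [AddCommGroup D] [Module R D] [AddCommGroup M] [Module R M] (hE : Module.Injective R E)
    {h : E →ₗ[R] D} {f : D →ₗ[R] M} (hfh : f ∘ₗ h = 0)
    (hf : ∀ N ≤ LinearMap.ker f, Module.Injective R N → N = ⊥) :
    IsEssential (LinearMap.ker h) := by
  intro L hL
  have hull := isInjectiveHull_hullMap (ModuleCat.of R L)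
  obtain ⟨j, hj⟩ := hE.out _ hull.mono L.subtype
  have hhj : Function.Injective (h ∘ₗ j) := hull.injective_of_comp <| by
    rw [LinearMap.comp_assoc, show j ∘ₗ hullMap _ = L.subtype from LinearMap.ext hj]
    rwa [← LinearMap.domRestrict, LinearMap.injective_domRestrict_iff]
  have hbot : LinearMap.range (h ∘ₗ j) = ⊥ := by
    refine hf _ ?_ (injective_range hull.injective_module hhj)
    rw [LinearMap.range_le_ker_iff, ← LinearMap.comp_assoc, hfh, LinearMap.zero_comp]
  have : Subsingleton (LinearMap.range (h ∘ₗ j)) := Submodule.subsingleton_iff_eq_bot.2 hbot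
  have := (LinearEquiv.ofInjective _ hhj).toEquiv.subsingleton
  exact Submodule.subsingleton_iff_eq_bot.1 hull.mono.subsingleton

theorem bijective_of_isEssential {D : Type u} [AddCommGroup D] [Module R D]
    (hD : Module.Injective R D) {N : Submodule R D} (hN : IsEssential N) {g : D →ₗ[R] D}
    (hg : ∀ x ∈ N, g x = x) : Function.Bijective g := by
  have hinj : Function.Injective g := by
    refine LinearMap.ker_eq_bot.1 (hN _ (Submodule.disjoint_def.2 fun x hx hxN => ?_))
    rw [← hg x hxN]
    exact hx
  obtain ⟨L, hL⟩ := exists_isCompl_of_injective _ (injective_range hD hinj)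
  have hLbot : L = ⊥ :=
    hN _ (hL.disjoint.symm.mono_right fun x hx => LinearMap.mem_range.2 ⟨x, hg x hx⟩)
  refine ⟨hinj, LinearMap.range_eq_top.1 ?_⟩
  rw [← hL.sup_eq_top, hLbot, sup_bot_eq]

theorem bijective_of_comp_eq {D M : Type u} [AddCommGroup D] [Module R D] [AddCommGroup M]
    [Module R M] (hD : Module.Injective R D) {f : D →ₗ[R] M}
    (hf : ∀ N ≤ LinearMap.ker f, Module.Injective R N → N = ⊥) {g : D →ₗ[R] D}
    (hg : f = f ∘ₗ g) : Function.Bijective g := by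
  have hfg : f ∘ₗ (LinearMap.id - g) = 0 := by
    rw [LinearMap.comp_sub, ← hg, LinearMap.comp_id, sub_self]
  exact bijective_of_isEssential hD (isEssential_ker_of_comp_eq_zero hD hfg hf)
    fun x hx => (sub_eq_zero.1 hx).symm

theorem IsPrecover.comp_subtype {P : ObjectProperty (ModuleCat.{u} R)} {D M : ModuleCat.{u} R}
    {f : D →ₗ[R] M} (hf : IsPrecover P f) {L D₁ : Submodule R D} (hLD : IsCompl L D₁)
    (hL : L ≤ LinearMap.ker f) (hD₁ : P (ModuleCat.of R D₁)) :
    IsPrecover P (D := ModuleCat.of R D₁) (f ∘ₗ D₁.subtype) := by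
  refine ⟨hD₁, fun D' hD' f' => ?_⟩
  obtain ⟨g, rfl⟩ := hf.2 D' hD' f'
  refine ⟨D₁.projectionOnto L hLD.symm ∘ₗ g, LinearMap.ext fun x => ?_⟩
  have hx : f (L.projection D₁ hLD (g x)) = 0 := hL (Submodule.projection_apply_mem hLD (g x))
  calc f (g x) = f (L.projection D₁ hLD (g x) + D₁.projection L hLD.symm (g x)) := by
        rw [Submodule.projection_add_projection_eq_self]
    _ = f (D₁.projection L hLD.symm (g x)) := by rw [map_add, hx, zero_add]

variable [IsNoetherianRing R]

theorem exists_maximal_injective_le {E : Type u} [AddCommGroup E] [Module R E]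
    (K : Submodule R E) : ∃ L, Maximal (fun L => L ≤ K ∧ Module.Injective R L) L := by
  obtain ⟨L, -, hL⟩ := zorn_le_nonempty₀ {L : Submodule R E | L ≤ K ∧ Module.Injective R L}
    (fun c hc hchain N₀ hN₀ => ⟨sSup c, ⟨sSup_le fun N hN => (hc hN).1,
      injective_sSup_of_directedOn ⟨N₀, hN₀⟩ hchain.directedOn fun N hN => (hc hN).2⟩,
      fun _ => le_sSup⟩)
    ⊥ ⟨bot_le, ⟨fun _ _ _ _ _ _ _ _ _ => ⟨0, fun _ => Subsingleton.elim _ _⟩⟩⟩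
  exact ⟨L, hL⟩

theorem exists_injClass_cover (Y : Set (PrimeSpectrum R)) (M : ModuleCat.{u} R) :
    ∃ (D : ModuleCat.{u} R) (f : D →ₗ[R] M), IsCover (injClass Y) f := by
  obtain ⟨D, f, hf⟩ := exists_injClass_precover Y M
  have hD := injective_of_injClass hf.1
  obtain ⟨L, hL⟩ := exists_maximal_injective_le (LinearMap.ker f)
  obtain ⟨D₁, hD₁⟩ := exists_isCompl_of_injective L hL.prop.2
  refine ⟨ModuleCat.of R D₁, f ∘ₗ D₁.subtype, hf.comp_subtype hD₁ hL.prop.1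
    (injClass_of_isSummand (isSummand_of_isCompl hD₁.symm) hf.1), fun g hg =>
    bijective_of_comp_eq (injective_of_isCompl hD hD₁.symm) (fun N hN hNinj => ?_) hg⟩
  let N' : Submodule R D := N.map D₁.subtype
  have hN' : Module.Injective R N' :=
    injective_of_equiv (N.equivMapOfInjective _ D₁.injective_subtype) hNinj
  have hdisj : Disjoint L N' := hD₁.disjoint.mono_right (Submodule.map_subtype_le _ _)
  have hle : N' ≤ LinearMap.ker f := by
    rwa [Submodule.map_le_iff_le_comap, ← LinearMap.ker_comp]
  have hN'L : N' ≤ L := le_sup_right.trans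
    (hL.2 ⟨sup_le hL.prop.1 hle, injective_sup_of_disjoint hL.prop.2 hN' hdisj⟩ le_sup_left)
  exact Submodule.map_injective_of_injective D₁.injective_subtype
    ((hdisj.symm.eq_bot_of_le hN'L).trans (Submodule.map_bot _).symm)

end Cover

section ExtClass

variable {R : Type u} [CommRing R] {Y : ℕ → Set (PrimeSpectrum R)}

/-- The modules `X` with `Extⁱ(R/𝔭, X) = 0` for all `i` and all primes `𝔭 ∉ Y_i`. Over a noetherian
ring this describes `C(Y₀, Y₁, …)` without injective hulls, so that long exact sequences apply. -/
def extClass (Y : ℕ → Set (PrimeSpectrum R)) : ObjectProperty (ModuleCat.{u} R) := fun X =>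
  ∀ i, ∀ p ∉ Y i, ExtZero (ModuleCat.of R (R ⧸ p.asIdeal)) X i

theorem extClass.homZero {X : ModuleCat.{u} R} (h : extClass Y X) : HomZero (Y 0) X :=
  homZero_iff_extZero_zero.2 (h 0)

theorem extClass.mono {Y' : ℕ → Set (PrimeSpectrum R)} (hY : ∀ i, Y i ⊆ Y' i)
    {X : ModuleCat.{u} R} (h : extClass Y X) : extClass Y' X :=
  fun i p hp => h i p fun hpY => hp (hY i hpY)

theorem extClass.shift (hY : Monotone Y) {X : ModuleCat.{u} R} {i : ℕ}
    (h : extClass (fun j => Y (j + i)) X) : extClass (fun j => Y (j + (i + 1))) X :=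
  h.mono fun _ => hY (Nat.le_succ _)

theorem extClass_pi {ι : Type u} {X : ι → ModuleCat.{u} R} (h : ∀ j, extClass Y (X j)) :
    extClass Y (ModuleCat.of R (∀ j, X j)) :=
  fun i p hp => extZero_pi fun j => h j i p hp

theorem extClass_of_injective {X : ModuleCat.{u} R} (hX : Module.Injective R X)
    (h : HomZero (Y 0) X) : extClass Y X
  | 0, p, hp => homZero_iff_extZero_zero.1 h p hp
  | i + 1, _, _ => extZero_of_injective _ hX i

section ShortExact

variable {A B C : ModuleCat.{u} R} {f : A →ₗ[R] B} {g : B →ₗ[R] C}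

theorem extClass.coker (hY : Monotone Y) (h : IsShortExact f g) (hA : extClass Y A)
    (hB : extClass Y B) : extClass (fun i => Y (i + 1)) C := fun i p hp =>
  subsingleton_ext_right_X₃ h.shortExact (hB i p fun hpY => hp (hY (Nat.le_succ i) hpY))
    (hA (i + 1) p hp)

theorem extClass.ker (h : IsShortExact f g) (hB : extClass Y B)
    (hC : extClass (fun i => Y (i + 1)) C) : extClass Y A
  | 0, p, hp => homZero_iff_extZero_zero.1 (hB.homZero.of_injective h.injective) p hp
  | i + 1, p, hp => subsingleton_ext_right_X₁ h.shortExact (hC i p hp) (hB (i + 1) p hp)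

end ShortExact

theorem extClass.hull {X : ModuleCat.{u} R} (h : extClass Y X) : extClass Y (injectiveHull X) :=
  extClass_of_injective (isInjectiveHull_hullMap X).injective_module
    ((isInjectiveHull_hullMap X).homZero h.homZero)

theorem isShortExact_hull (X : ModuleCat.{u} R) :
    IsShortExact (C := ModuleCat.of R (injectiveHull X ⧸ LinearMap.range (hullMap X)))
      (hullMap X) (LinearMap.range (hullMap X)).mkQ :=
  isShortExact_coker (isInjectiveHull_hullMap X).mono

theorem extClass.hull_coker (hY : Monotone Y) {X : ModuleCat.{u} R} {i : ℕ}
    (h : extClass (fun j => Y (j + i)) X) :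
    extClass (fun j => Y (j + (i + 1)))
      (ModuleCat.of R (injectiveHull X ⧸ LinearMap.range (hullMap X))) :=
  (h.coker (fun _ _ hab => hY (Nat.add_le_add_right hab i)) (isShortExact_hull X) h.hull).mono
    fun j => by rw [Nat.add_right_comm, Nat.add_assoc]

theorem extClass.cosyzygy (hY : Monotone Y) {X : ModuleCat.{u} R} (h : extClass Y X) (i : ℕ) :
    extClass (fun j => Y (j + i)) (cosyzygy X i) := by
  induction i with
  | zero => exact h
  | succ i ih => exact ih.hull_coker hY

theorem extZero_cosyzygy {X : ModuleCat.{u} R} (h : ∀ i, HomZero (Y i) (cosyzygy X i)) {m i : ℕ}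
    {p : PrimeSpectrum R} (hp : p ∉ Y (m + i)) :
    ExtZero (ModuleCat.of R (R ⧸ p.asIdeal)) (cosyzygy X i) m := by
  induction m generalizing i with
  | zero => exact homZero_iff_extZero_zero.1 (h i) p (by rwa [Nat.zero_add] at hp)
  | succ m ih =>
    exact subsingleton_ext_right_X₁ (isShortExact_hull (cosyzygy X i)).shortExact
      (ih (i := i + 1) (by rwa [← Nat.add_assoc, Nat.add_right_comm]))
      (extZero_of_injective _ (isInjectiveHull_hullMap _).injective_module m)

theorem extClass_iff_homZero_cosyzygy (hY : Monotone Y) {X : ModuleCat.{u} R} :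
    extClass Y X ↔ ∀ i, HomZero (Y i) (cosyzygy X i) :=
  ⟨fun h i => by simpa only [Nat.zero_add] using (h.cosyzygy hY i).homZero,
    fun h _ _ hp => extZero_cosyzygy h (i := 0) hp⟩

theorem extClass_eq_cotiltClass [IsNoetherianRing R] (hY : Monotone Y)
    (hgen : ∀ i, IsLowerSet (Y i)) : extClass Y = cotiltClass Y := by
  ext X
  rw [extClass_iff_homZero_cosyzygy hY]
  refine forall_congr' fun i => ?_
  have hull := isInjectiveHull_hullMap (cosyzygy X i)
  rw [← homZero_iff_exists_equiv (hgen i) hull.injective_module]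
  exact ⟨hull.homZero, fun h => h.of_injective hull.mono⟩

theorem isShortExact_rangeRestrict {M A B : ModuleCat.{u} R} {f : M →ₗ[R] A} {g : A →ₗ[R] B}
    (hf : Function.Injective f) (h : Function.Exact f g) :
    IsShortExact (C := ModuleCat.of R (LinearMap.range g)) f g.rangeRestrict :=
  ⟨hf, fun x => by rw [← h x]; exact Subtype.ext_iff, g.surjective_rangeRestrict⟩

theorem extZero_of_exact (hY : Monotone Y) {i : ℕ} {p : PrimeSpectrum R} (hp : p ∉ Y i)
    {M : ModuleCat.{u} R} {D : ℕ → ModuleCat.{u} R} {ι : M →ₗ[R] D 0}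
    {d : ∀ i, D i →ₗ[R] D (i + 1)} (hι : Function.Injective ι) (hι0 : Function.Exact ι (d 0))
    (hd : ∀ i, Function.Exact (d i) (d (i + 1))) (hD : ∀ j ≤ i, extClass Y (D j)) :
    ExtZero (ModuleCat.of R (R ⧸ p.asIdeal)) M i := by
  induction i generalizing M D with
  | zero => exact homZero_iff_extZero_zero.1 ((hD 0 le_rfl).homZero.of_injective hι) p hp
  | succ i ih =>
    refine subsingleton_ext_right_X₁ (isShortExact_rangeRestrict hι hι0).shortExact
      (ih (fun h => hp (hY (Nat.le_succ i) h)) (D := fun j => D (j + 1))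
        (d := fun j => d (j + 1)) (ι := (LinearMap.range (d 0)).subtype)
        Subtype.val_injective ?_ (fun j => hd (j + 1)) fun j hj => hD (j + 1) (Nat.succ_le_succ hj))
      (hD 0 (Nat.zero_le _) _ p hp)
    exact fun x => (hd 0 x).trans (by rw [Submodule.coe_subtype, Subtype.range_coe]; rfl)

end ExtClass

section Existence

variable {R : Type u} [CommRing R] [IsNoetherianRing R]

theorem exists_iterated_covers (k : ℕ) (Y : ℕ → Set (PrimeSpectrum R)) (M : ModuleCat.{u} R) :
    ∃ (K E : ℕ → ModuleCat.{u} R) (ν : ∀ j, K j →ₗ[R] E j) (Φ : ∀ j, E j →ₗ[R] K (j + 1)),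
      Nonempty (K k ≃ₗ[R] M) ∧ ∀ j < k, IsCover (injClass (Y j)) (Φ j) ∧
        Function.Injective (ν j) ∧ Function.Exact (ν j) (Φ j) := by
  induction k generalizing Y with
  | zero =>
    exact ⟨fun _ => M, fun _ => M, fun _ => 0, fun _ => 0, ⟨LinearEquiv.refl R M⟩,
      fun j hj => absurd hj (Nat.not_lt_zero j)⟩
  | succ k ih =>
    obtain ⟨K, E, ν, Φ, hK, h⟩ := ih fun j => Y (j + 1)
    obtain ⟨D, f, hf⟩ := exists_injClass_cover (Y 0) (K 0)
    refine ⟨fun j => Nat.casesOn j (ModuleCat.of R (LinearMap.ker f)) K,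
      fun j => Nat.casesOn j D E, fun j => Nat.casesOn j (LinearMap.ker f).subtype ν,
      fun j => Nat.casesOn j f Φ, hK, ?_⟩
    rintro (_ | j) hj
    · exact ⟨hf, Subtype.val_injective, LinearMap.exact_subtype_ker_map f⟩
    · exact h j (Nat.lt_of_succ_lt_succ hj)

theorem exists_precoverComplex_byCovers {Y : ℕ → Set (PrimeSpectrum R)} {p : PrimeSpectrum R}
    (hp : ∃ j, p ∈ Y j) : ∃ D : PrecoverComplex Y p, D.ByCovers := by
  classical
  obtain ⟨K, E, ν, Φ, ⟨e⟩, h⟩ := exists_iterated_covers (Nat.find hp) Y (primeHull p)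
  exact ⟨⟨Nat.find hp, ⟨Nat.find_spec hp, fun j hj => Nat.find_min' hp hj⟩, K, E, ν, Φ, e,
    fun j hj => (h j hj).1.1, fun j hj => (h j hj).2.1, fun j hj => (h j hj).2.2⟩,
    fun j hj => (h j hj).1⟩

end Existence

namespace PrecoverComplex

variable {R : Type u} [CommRing R] {Y : ℕ → Set (PrimeSpectrum R)} {p : PrimeSpectrum R}
  (D : PrecoverComplex Y p)

theorem injective_top : Module.Injective R (D.K D.k) :=
  injective_of_equiv D.top.symm (injective_primeHull p)

theorem homZero_top (hgen : ∀ i, IsLowerSet (Y i)) : HomZero (Y D.k) (D.K D.k) :=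
  (homZero_primeHull (hgen _) D.isLeast_k.1).of_injective (f := D.top.toLinearMap) D.top.injective

variable [IsNoetherianRing R]

theorem injective_E {i : ℕ} (hi : i < D.k) : Module.Injective R (D.E i) :=
  injective_of_injClass (D.isPrecover i hi).1

theorem homZero_E (hgen : ∀ i, IsLowerSet (Y i)) {i : ℕ} (hi : i < D.k) : HomZero (Y i) (D.E i) :=
  ((injClass_iff (hgen i)).1 (D.isPrecover i hi).1).2

variable (hmono : Monotone Y) (hgen : ∀ i, IsLowerSet (Y i))

include hmono hgen

-- Maps to `K_{i+1}` extend to the injective hull of `X`, which lies in `I(Y_i)`.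
theorem exists_lift {i : ℕ} (hi : i < D.k)
    (hext : ∀ X, extClass (fun j => Y (j + (i + 1))) X → ExtZero X (D.K (i + 1)) 1)
    {X : ModuleCat.{u} R} (hX : extClass (fun j => Y (j + i)) X) (φ : X →ₗ[R] D.K (i + 1)) :
    ∃ ψ : X →ₗ[R] D.E i, D.Φ i ∘ₗ ψ = φ := by
  obtain ⟨φ', rfl⟩ := (isShortExact_hull X).exists_extend (hext _ (hX.hull_coker hmono)) φ
  have hE : injClass (Y i) (injectiveHull X) := (injClass_iff (hgen i)).2
    ⟨(isInjectiveHull_hullMap X).injective_module,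
      by simpa only [Nat.zero_add] using hX.hull.homZero⟩
  obtain ⟨g, rfl⟩ := (D.isPrecover i hi).2 _ hE φ'
  exact ⟨g ∘ₗ hullMap X, rfl⟩

variable (hR : extClass Y (ModuleCat.of R R))

include hR

theorem isShortExact_of_extZero {i : ℕ} (hi : i < D.k)
    (hext : ∀ X, extClass (fun j => Y (j + (i + 1))) X → ExtZero X (D.K (i + 1)) 1) :
    IsShortExact (D.ν i) (D.Φ i) := by
  refine ⟨D.ν_injective i hi, D.ν_exact i hi, fun x => ?_⟩
  obtain ⟨ψ, hψ⟩ := D.exists_lift hmono hgen hi hext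
    (hR.mono fun j => hmono (Nat.le_add_right j i)) (LinearMap.toSpanSingleton R _ x)
  exact ⟨ψ (1 : R), (LinearMap.congr_fun hψ (1 : R)).trans (one_smul R x)⟩

theorem extZero_K {i : ℕ} (hi : i ≤ D.k) {X : ModuleCat.{u} R}
    (hX : extClass (fun j => Y (j + i)) X) (m : ℕ) : ExtZero X (D.K i) (m + 1) := by
  induction hi using Nat.decreasingInduction generalizing X m with
  | self => exact extZero_of_injective _ D.injective_top m
  | of_succ i hi ih =>
    have hext : ∀ X, extClass (fun j => Y (j + (i + 1))) X → ExtZero X (D.K (i + 1)) 1 :=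
      fun X hX => ih hX 0
    have hses := (D.isShortExact_of_extZero hmono hgen hR hi hext).shortExact
    cases m with
    | zero =>
      refine subsingleton_ext_one_right_X₁ hses (extZero_of_injective X (D.injective_E hi) 0)
        fun φ => ?_
      obtain ⟨ψ, hψ⟩ := D.exists_lift hmono hgen hi hext hX φ.hom
      exact ⟨ModuleCat.ofHom ψ, ModuleCat.hom_ext hψ⟩
    | succ m =>
      exact subsingleton_ext_right_X₁ hses (ih (hX.shift hmono) m)
        (extZero_of_injective X (D.injective_E hi) _)

theorem isShortExact {i : ℕ} (hi : i < D.k) : IsShortExact (D.ν i) (D.Φ i) :=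
  D.isShortExact_of_extZero hmono hgen hR hi fun _ hX => D.extZero_K hmono hgen hR hi hX 0

theorem extClass_K {i : ℕ} (hi : i ≤ D.k) : extClass (fun j => Y (j + i)) (D.K i) := by
  induction hi using Nat.decreasingInduction with
  | self =>
    refine extClass_of_injective D.injective_top ?_
    simpa only [Nat.zero_add] using D.homZero_top hgen
  | of_succ i hi ih =>
    refine extClass.ker (D.isShortExact hmono hgen hR hi)
      (extClass_of_injective (D.injective_E hi) ?_)
      (ih.mono fun j => by rw [Nat.add_right_comm, Nat.add_assoc])
    simpa only [Nat.zero_add] using D.homZero_E hgen hi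

theorem hasInjectiveDimensionLE_K {i : ℕ} (hi : i ≤ D.k) {m : ℕ} (hm : D.k ≤ m + i) :
    HasInjectiveDimensionLE (D.K i) m := by
  induction hi using Nat.decreasingInduction generalizing m with
  | self =>
    have : Injective (D.K D.k) := (Module.injective_iff_injective_object R _).1 D.injective_top
    exact hasInjectiveDimensionLT_of_ge _ 1 _ (Nat.le_add_left 1 m)
  | of_succ i hi ih =>
    obtain ⟨m, rfl⟩ : ∃ l, m = l + 1 := ⟨m - 1, by omega⟩
    have : Injective (D.E i) := (Module.injective_iff_injective_object R _).1 (D.injective_E hi)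
    exact (D.isShortExact hmono hgen hR hi).shortExact.hasInjectiveDimensionLT_X₁ _
      (ih (by omega)) (hasInjectiveDimensionLT_of_ge _ 1 _ (Nat.le_add_left 1 _))

end PrecoverComplex

section Pushout

variable {R : Type u} [CommRing R] {A B C : ModuleCat.{u} R} {f : A →ₗ[R] B} {g : B →ₗ[R] C}

namespace IsShortExact

theorem exists_desc (h : IsShortExact f g) {X : ModuleCat.{u} R} {φ : B →ₗ[R] X}
    (hφ : φ ∘ₗ f = 0) : ∃ ψ : C →ₗ[R] X, ψ ∘ₗ g = φ := by
  have := h.shortExact.epi_g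
  refine ⟨(h.shortExact.exact.desc (ModuleCat.ofHom φ) (ModuleCat.hom_ext hφ)).hom, ?_⟩
  exact congrArg ModuleCat.Hom.hom (h.shortExact.exact.g_desc _ _)

theorem exists_quotient (h : IsShortExact f g) {T Q : ModuleCat.{u} R} {i : B →ₗ[R] T}
    {q : T →ₗ[R] Q} (h' : IsShortExact i q) :
    ∃ (P : ModuleCat.{u} R) (π : T →ₗ[R] P) (j : C →ₗ[R] P) (r : P →ₗ[R] Q),
      IsShortExact (i ∘ₗ f) π ∧ IsShortExact j r := by
  obtain ⟨P, π, hπ⟩ : ∃ (P : ModuleCat.{u} R) (π : T →ₗ[R] P), IsShortExact (i ∘ₗ f) π :=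
    ⟨_, _, isShortExact_coker (h'.injective.comp h.injective)⟩
  obtain ⟨j, hj⟩ := h.exists_desc (φ := π ∘ₗ i)
    (by rw [LinearMap.comp_assoc, hπ.exact.linearMap_comp_eq_zero])
  obtain ⟨r, hr⟩ := hπ.exists_desc (X := Q) (φ := q) <| by
    rw [← LinearMap.comp_assoc, h'.exact.linearMap_comp_eq_zero, LinearMap.zero_comp]
  have hjg : ∀ b, j (g b) = π (i b) := LinearMap.congr_fun hj
  have hrπ : ∀ t, r (π t) = q t := LinearMap.congr_fun hr
  refine ⟨P, π, j, r, hπ, (injective_iff_map_eq_zero j).2 fun c hc => ?_, fun x => ?_, fun y => ?_⟩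
  · obtain ⟨b, rfl⟩ := h.surjective c
    obtain ⟨a, ha⟩ := (hπ.exact _).1 ((hjg b).symm.trans hc)
    rw [← h'.injective ha, h.exact.apply_apply_eq_zero]
  · obtain ⟨t, rfl⟩ := hπ.surjective x
    rw [hrπ, h'.exact t]
    constructor
    · rintro ⟨b, rfl⟩
      exact ⟨g b, hjg b⟩
    · rintro ⟨c, hc⟩
      obtain ⟨b, rfl⟩ := h.surjective c
      rw [hjg, ← sub_eq_zero, ← map_sub] at hc
      obtain ⟨a, ha⟩ := (hπ.exact _).1 hc
      exact ⟨b - f a, by rw [map_sub, sub_eq_iff_eq_add, ← sub_eq_iff_eq_add', ← ha]; rfl⟩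
  · obtain ⟨t, rfl⟩ := h'.surjective y
    exact ⟨_, hrπ t⟩

theorem exists_transpose (h : IsShortExact f g) {T Z V : ModuleCat.{u} R} {k : A →ₗ[R] Z}
    {π : Z →ₗ[R] V} (hπ : IsShortExact k π) {ι : T →ₗ[R] Z} {σ : Z →ₗ[R] B}
    (hσ : IsShortExact ι σ) (hf : σ ∘ₗ k = f) : ∃ r : V →ₗ[R] C, IsShortExact (π ∘ₗ ι) r := by
  subst hf
  obtain ⟨r, hr⟩ := hπ.exists_desc (X := C) (φ := g ∘ₗ σ)
    (by rw [LinearMap.comp_assoc, h.exact.linearMap_comp_eq_zero])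
  have hrπ : ∀ z, r (π z) = g (σ z) := LinearMap.congr_fun hr
  refine ⟨r, (injective_iff_map_eq_zero _).2 fun t ht => ?_, fun v => ?_, fun c => ?_⟩
  · obtain ⟨a, ha⟩ := (hπ.exact _).1 ht
    have ha0 : a = 0 := (map_eq_zero_iff _ h.injective).1
      ((congrArg σ ha).trans (hσ.exact.apply_apply_eq_zero t))
    rw [ha0, map_zero] at ha
    exact (map_eq_zero_iff _ hσ.injective).1 ha.symm
  · obtain ⟨z, rfl⟩ := hπ.surjective v
    rw [hrπ]
    constructor
    · intro hz
      obtain ⟨a, ha⟩ := (h.exact _).1 hz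
      obtain ⟨t, ht⟩ := (hσ.exact (z - k a)).1 (by rw [map_sub, ← ha]; exact sub_self _)
      refine ⟨t, ?_⟩
      rw [LinearMap.comp_apply, ht, map_sub, hπ.exact.apply_apply_eq_zero, sub_zero]
    · rintro ⟨t, ht⟩
      rw [← hrπ, ← ht, LinearMap.comp_apply, hrπ, hσ.exact.apply_apply_eq_zero, map_zero]
  · obtain ⟨z, rfl⟩ := (h.surjective.comp hσ.surjective) c
    exact ⟨π z, hrπ z⟩

theorem exists_pushout (h : IsShortExact f g) {T Q : ModuleCat.{u} R} {i : A →ₗ[R] T}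
    {q : T →ₗ[R] Q} (h' : IsShortExact i q) :
    ∃ (V : ModuleCat.{u} R) (j : T →ₗ[R] V) (r : V →ₗ[R] C) (j' : B →ₗ[R] V) (r' : V →ₗ[R] Q),
      IsShortExact j r ∧ IsShortExact j' r' := by
  let k : A →ₗ[R] ModuleCat.of R (T × B) := i.prod f
  have hk : Function.Injective k := fun _ _ hab => h.injective (congrArg Prod.snd hab)
  obtain ⟨r, hr⟩ := h.exists_transpose (isShortExact_coker hk)
    (ι := LinearMap.inl R T B) (σ := LinearMap.snd R T B)
    ⟨LinearMap.inl_injective, Function.Exact.inl_snd, LinearMap.snd_surjective⟩ rfl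
  obtain ⟨r', hr'⟩ := h'.exists_transpose (isShortExact_coker hk)
    (ι := LinearMap.inr R T B) (σ := LinearMap.fst R T B)
    ⟨LinearMap.inr_injective, Function.Exact.inr_fst, LinearMap.fst_surjective⟩ rfl
  exact ⟨_, _, r, _, r', hr, hr'⟩

end IsShortExact

end Pushout

section ProdResolution

variable {R : Type u} [CommRing R]

/-- The modules `M` with an exact sequence `0 → C_{m-1} → ⋯ → C₀ → M → 0` whose terms `C_i` are
direct summands of products of copies of `C`, given by recursion on the kernel of `C₀ → M`. -/
def prodResolutionClass (C : ModuleCat.{u} R) : ℕ → ObjectProperty (ModuleCat.{u} R)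
  | 0 => fun M => Subsingleton M
  | m + 1 => fun M => ∃ (K D : ModuleCat.{u} R) (f : K →ₗ[R] D) (g : D →ₗ[R] M),
      IsShortExact f g ∧ prodClass C D ∧ prodResolutionClass C m K

variable {C : ModuleCat.{u} R}

theorem prodClass_of_subsingleton {D : ModuleCat.{u} R} [Subsingleton D] : prodClass C D :=
  ⟨PEmpty, 0, 0, LinearMap.ext fun _ => Subsingleton.elim _ _⟩

theorem extZero_of_prodClass {X D : ModuleCat.{u} R} (hX : leftPerp C X) (hD : prodClass C D)
    (i : ℕ) : ExtZero X D (i + 1) := by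
  obtain ⟨I, hI⟩ := hD
  exact ExtZero.of_isSummand (extZero_pi fun _ => hX (i + 1) (Nat.succ_pos i)) hI

theorem extZero_of_prodResolutionClass {m : ℕ} {X M : ModuleCat.{u} R} (hX : leftPerp C X)
    (h : prodResolutionClass C m M) (i : ℕ) : ExtZero X M (i + 1) := by
  induction m generalizing M i with
  | zero =>
    have : Subsingleton M := h
    exact extZero_of_prodClass hX prodClass_of_subsingleton i
  | succ m ih =>
    obtain ⟨K, D, f, g, hfg, hD, hK⟩ := h
    exact subsingleton_ext_right_X₃ hfg.shortExact (extZero_of_prodClass hX hD i) (ih hK (i + 1))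

theorem exists_exact_of_prodResolutionClass {m : ℕ} {M : ModuleCat.{u} R}
    (h : prodResolutionClass C m M) :
    ∃ (D : ℕ → ModuleCat.{u} R) (ε : D 0 →ₗ[R] M) (d : ∀ i, D (i + 1) →ₗ[R] D i),
      Function.Surjective ε ∧ Function.Exact (d 0) ε ∧ (∀ i, Function.Exact (d (i + 1)) (d i)) ∧
      (∀ i, prodClass C (D i)) ∧ ∀ i, m ≤ i → Subsingleton (D i) := by
  induction m generalizing M with
  | zero =>
    have : Subsingleton M := h
    have exact_zero : Function.Exact (0 : M →ₗ[R] M) (0 : M →ₗ[R] M) :=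
      fun x => ⟨fun _ => ⟨0, Subsingleton.elim _ _⟩, fun _ => Subsingleton.elim _ _⟩
    exact ⟨fun _ => M, 0, fun _ => 0, fun x => ⟨0, Subsingleton.elim _ _⟩, exact_zero,
      fun _ => exact_zero, fun _ => prodClass_of_subsingleton, fun _ _ => this⟩
  | succ m ih =>
    obtain ⟨K, D₀, f, g, hfg, hD₀, hK⟩ := h
    obtain ⟨D, ε, d, hε, hdε, hd, hD, hm⟩ := ih hK
    refine ⟨fun i => Nat.casesOn i D₀ D, g, fun i => Nat.casesOn i (f ∘ₗ ε) d, hfg.surjective,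
      hε.comp_exact_iff_exact.2 hfg.exact, ?_, ?_, ?_⟩
    · rintro (_ | i)
      · exact hfg.injective.comp_exact_iff_exact.2 hdε
      · exact hd i
    · rintro (_ | i)
      · exact hD₀
      · exact hD i
    · rintro (_ | i) hi
      · exact absurd hi (Nat.not_succ_le_zero m)
      · exact hm i (Nat.le_of_succ_le_succ hi)

end ProdResolution

section Cogeneration

variable {R : Type u} [CommRing R] {C : ModuleCat.{u} R}

/-- The canonical map `X → C^Hom(X, C)`; it is injective iff `X` is cogenerated by `C`. -/
def evalMap (C X : ModuleCat.{u} R) : X →ₗ[R] ModuleCat.of R ((X →ₗ[R] C) → C) :=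
  LinearMap.pi fun φ => φ

theorem evalMap_injective {X : ModuleCat.{u} R} (h : ∀ x : X, x ≠ 0 → ∃ φ : X →ₗ[R] C, φ x ≠ 0) :
    Function.Injective (evalMap C X) :=
  (injective_iff_map_eq_zero _).2 fun x hx => by
    by_contra hne
    obtain ⟨φ, hφ⟩ := h x hne
    exact hφ (congrFun hx φ)

/-- The iterated cokernels of the canonical maps `X → C^Hom(X, C)`: the analogue of the cosyzygies
for coresolutions by products of copies of `C`. -/
def evalCoker (C X : ModuleCat.{u} R) : ℕ → ModuleCat.{u} R
  | 0 => X
  | i + 1 => ModuleCat.of R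
      (((evalCoker C X i →ₗ[R] C) → C) ⧸ LinearMap.range (evalMap C (evalCoker C X i)))

variable (hpow : ∀ κ : Type u, leftPerp C (ModuleCat.of R (κ → C)))
  (hcog : ∀ X, leftPerp C X → Function.Injective (evalMap C X))

include hpow

theorem leftPerp_coker_evalMap {X : ModuleCat.{u} R} (hX : leftPerp C X)
    (hinj : Function.Injective (evalMap C X)) :
    leftPerp C (ModuleCat.of R (((X →ₗ[R] C) → C) ⧸ LinearMap.range (evalMap C X))) := by
  have hex := (isShortExact_coker hinj).shortExact
  rintro (_ | _ | i) hi
  · exact absurd hi (Nat.not_succ_le_zero 0)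
  · exact subsingleton_ext_one_left_X₃ hex (hpow _ 1 le_rfl)
      fun φ => ⟨ModuleCat.ofHom (LinearMap.proj φ.hom), rfl⟩
  · exact subsingleton_ext_left_X₃ hex (hX _ (Nat.succ_pos i)) (hpow _ _ hi)

include hcog

theorem leftPerp_evalCoker {X : ModuleCat.{u} R} (hX : leftPerp C X) (i : ℕ) :
    leftPerp C (evalCoker C X i) := by
  induction i with
  | zero => exact hX
  | succ i ih => exact leftPerp_coker_evalMap hpow ih (hcog _ ih)

theorem leftPerp_le_cogClass (n : ℕ) : leftPerp C ≤ cogClass n C := by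
  intro X hX
  have hinj : ∀ i, Function.Injective (evalMap C (evalCoker C X i)) :=
    fun i => hcog _ (leftPerp_evalCoker hpow hcog hX i)
  have hexact : ∀ i, Function.Exact (evalMap C (evalCoker C X i))
      (evalMap C (evalCoker C X (i + 1)) ∘ₗ
        (LinearMap.range (evalMap C (evalCoker C X i))).mkQ) := fun i =>
    (hinj (i + 1)).comp_exact_iff_exact.2 (isShortExact_coker (hinj i)).exact
  exact ⟨fun i => ModuleCat.of R ((evalCoker C X i →ₗ[R] C) → C), evalMap C X,
    fun i => evalMap C (evalCoker C X (i + 1)) ∘ₗ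
      (LinearMap.range (evalMap C (evalCoker C X i))).mkQ, hinj 0, hexact 0,
    fun i => (Submodule.mkQ_surjective _).comp_exact_iff_exact.2 (hexact (i + 1)),
    fun i _ => ⟨_, ⟨LinearEquiv.refl R _⟩⟩⟩

-- Auslander–Buchweitz approximation, by induction on the vanishing degree `m`.
theorem exists_leftPerp_approximation {m : ℕ} {M : ModuleCat.{u} R}
    (hM : ∀ i, m < i → ExtZero M C i) :
    ∃ (K X : ModuleCat.{u} R) (f : K →ₗ[R] X) (g : X →ₗ[R] M),
      IsShortExact f g ∧ leftPerp C X ∧ prodResolutionClass C m K := by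
  induction m generalizing M with
  | zero =>
    refine ⟨ModuleCat.of R PUnit, M, 0, LinearMap.id, ⟨Function.injective_of_subsingleton _, ?_,
      Function.surjective_id⟩, hM, inferInstanceAs (Subsingleton PUnit)⟩
    exact fun x => ⟨fun hx => ⟨0, hx.symm⟩, fun ⟨_, hx⟩ => hx.symm⟩
  | succ m ih =>
    obtain ⟨N, F, s, p, hsp, hF⟩ := exists_projective_presentation M
    have hF' : ∀ i, ExtZero F C (i + 1) := fun i => Ext.subsingleton_of_projective F C i
    have hN : ∀ i, m < i → ExtZero N C i := by
      rintro (_ | i) hi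
      · exact absurd hi (Nat.not_lt_zero m)
      · exact subsingleton_ext_left_X₁ hsp.shortExact (hF' i) (hM _ (Nat.succ_lt_succ hi))
    obtain ⟨K, X, f, g, hfg, hX, hK⟩ := ih hN
    obtain ⟨P, π, j, r, hπ, hjr⟩ := hfg.exists_quotient (isShortExact_coker (hcog X hX))
    obtain ⟨V, a, b, c, d, hab, hcd⟩ := hsp.exists_pushout hjr
    refine ⟨P, V, a, b, hab, ?_, K, _, _, π, hπ, ⟨_, isSummand_of_equiv (LinearEquiv.refl R _)⟩, hK⟩
    rintro (_ | i) hi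
    · exact absurd hi (Nat.not_succ_le_zero 0)
    · exact subsingleton_ext_left_X₂ hcd.shortExact (hF' i)
        (leftPerp_coker_evalMap hpow hX (hcog X hX) _ hi)

theorem prodResolutionClass_of_injective {n : ℕ} (hdim : HasInjectiveDimensionLE C n)
    {W : ModuleCat.{u} R} (hW : Module.Injective R W) : prodResolutionClass C (n + 1) W := by
  obtain ⟨K, X, f, g, hfg, hX, hK⟩ := exists_leftPerp_approximation hpow hcog (M := W)
    fun i hi => hdim.subsingleton _ _ i hi W
  have hX' := leftPerp_coker_evalMap hpow hX (hcog X hX)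
  have hsplit := (isShortExact_coker (hcog X hX)).isSummand_middle <|
    subsingleton_ext_right_X₂ hfg.shortExact (extZero_of_prodResolutionClass hX' hK 0)
      (extZero_of_injective _ hW 0)
  exact ⟨K, X, f, g, hfg, ⟨_, hsplit⟩, hK⟩

theorem isNCotilting_of_cogenerates {n : ℕ} (hdim : HasInjectiveDimensionLE C n) :
    IsNCotilting n C := by
  obtain ⟨W, hW, hsep⟩ := has_injective_coseparator _ (ModuleCat.isSeparator R)
  obtain ⟨D, ε, d, hε, hdε, hd, hD, hm⟩ := exists_exact_of_prodResolutionClass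
    (prodResolutionClass_of_injective hpow hcog hdim
      ((Module.injective_iff_injective_object R W).2 hW))
  exact ⟨⟨⟨n, hdim⟩, hpow, W, n, D, ε, d, hW, hsep, hε, hdε, hd, fun i _ => hD i, hm⟩, hdim⟩

end Cogeneration

section Main

variable {R : Type u} [CommRing R] {Y : ℕ → Set (PrimeSpectrum R)} (D : ∀ p, PrecoverComplex Y p)

theorem prodClass_component (p : PrimeSpectrum R) :
    prodClass (cotiltModule D) (D p).component := by
  classical
  refine ⟨PUnit, LinearMap.pi fun _ => LinearMap.single R (fun p => (D p).component) p,
    LinearMap.proj p ∘ₗ LinearMap.proj PUnit.unit, LinearMap.ext fun x => ?_⟩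
  exact Pi.single_eq_same (M := fun p => (D p).component) p x

variable [IsNoetherianRing R] (hmono : Monotone Y) (hgen : ∀ i, IsLowerSet (Y i))
  (hR : extClass Y (ModuleCat.of R R))

include hmono hgen hR

theorem extClass_cotiltModule : extClass Y (cotiltModule D) :=
  extClass_pi fun p => (D p).extClass_K hmono hgen hR (Nat.zero_le _)

theorem extClass_le_leftPerp : extClass Y ≤ leftPerp (cotiltModule D) := by
  rintro X hX (_ | i) hi
  · exact absurd hi (Nat.not_succ_le_zero 0)
  · exact extZero_pi fun p => (D p).extZero_K hmono hgen hR (Nat.zero_le _) hX i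

theorem leftPerp_pow_cotiltModule (κ : Type u) :
    leftPerp (cotiltModule D) (ModuleCat.of R (κ → cotiltModule D)) :=
  extClass_le_leftPerp D hmono hgen hR _
    (extClass_pi fun _ => extClass_cotiltModule D hmono hgen hR)

theorem cogClass_le_extClass {n : ℕ} (hYn : Y n = Set.univ) :
    cogClass n (cotiltModule D) ≤ extClass Y := by
  rintro M ⟨E, ι, d, hι, hι0, hd, hE⟩ i p hp
  have hin : i < n := by
    by_contra! h
    exact hp (hmono h (hYn ▸ Set.mem_univ p))
  refine extZero_of_exact hmono hp hι hι0 hd fun j hj => ?_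
  obtain ⟨I, ⟨e⟩⟩ := hE j (hj.trans_lt hin)
  have hpi : extClass Y (ModuleCat.of R (I → cotiltModule D)) :=
    extClass_pi fun _ => extClass_cotiltModule D hmono hgen hR
  exact fun l q hq => (hpi l q hq).of_isSummand (isSummand_of_equiv e)

theorem hasInjectiveDimensionLE_cotiltModule {n : ℕ} (hYn : Y n = Set.univ) :
    HasInjectiveDimensionLE (cotiltModule D) n :=
  hasInjectiveDimensionLT_pi fun p => (D p).hasInjectiveDimensionLE_K hmono hgen hR
    (Nat.zero_le _) ((D p).isLeast_k.2 (show p ∈ Y n from hYn ▸ Set.mem_univ p))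

theorem extZero_K_of_leftPerp {X : ModuleCat.{u} R} (hX : leftPerp (cotiltModule D) X)
    (p : PrimeSpectrum R) {i : ℕ} (hi : i ≤ (D p).k) (m : ℕ) : ExtZero X ((D p).K i) (m + 1) := by
  induction i generalizing m with
  | zero => exact extZero_of_prodClass hX (prodClass_component D p) m
  | succ i ih =>
    exact subsingleton_ext_right_X₃ ((D p).isShortExact hmono hgen hR hi).shortExact
      (extZero_of_injective X ((D p).injective_E hi) m) (ih (Nat.le_of_succ_le hi) (m + 1))

-- A map to `E(R/q)` with `q ∈ Y_i` either lands in a factor of `C`, or lifts along the last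
-- precover of the complex of `q` to a module in `I(Y_j)` with `j < i`.
theorem exists_map_cotiltModule_ne_zero {X : ModuleCat.{u} R} (hX : leftPerp (cotiltModule D) X)
    {x : X} {i : ℕ} {E : ModuleCat.{u} R} (hE : injClass (Y i) E) {f : X →ₗ[R] E}
    (hf : f x ≠ 0) : ∃ φ : X →ₗ[R] cotiltModule D, φ x ≠ 0 := by
  classical
  induction i using Nat.strong_induction_on generalizing E with
  | h i ih =>
    obtain ⟨q, hq, ψ, hψ⟩ := exists_map_primeHull_ne_zero hE hf
    have htop : ∃ φ : X →ₗ[R] (D q).K (D q).k, φ x ≠ 0 :=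
      ⟨(D q).top.symm.toLinearMap ∘ₗ ψ ∘ₗ f, (D q).top.symm.map_ne_zero_iff.2 hψ⟩
    have hki : (D q).k ≤ i := (D q).isLeast_k.2 hq
    obtain ⟨k, hk⟩ : ∃ k, k = (D q).k := ⟨_, rfl⟩
    rw [← hk] at htop hki
    obtain ⟨φ, hφ⟩ := htop
    rcases k with _ | l
    · refine ⟨LinearMap.single R (fun p => (D p).component) q ∘ₗ φ, fun h => hφ ?_⟩
      exact (Pi.single_eq_zero_iff (M := fun p => (D p).component)).1 h
    · have hl : l < (D q).k := hk ▸ Nat.lt_succ_self l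
      obtain ⟨χ, rfl⟩ := ((D q).isShortExact hmono hgen hR hl).exists_lift
        (extZero_K_of_leftPerp D hmono hgen hR hX q hl.le 0) φ
      have hχ : χ x ≠ 0 := fun h => hφ (by rw [LinearMap.comp_apply, h, map_zero])
      exact ih l hki ((D q).isPrecover l hl).1 hχ

variable {n : ℕ} (hYn : Y n = Set.univ)

include hYn

theorem evalMap_cotiltModule_injective {X : ModuleCat.{u} R} (hX : leftPerp (cotiltModule D) X) :
    Function.Injective (evalMap (cotiltModule D) X) := by
  have hull := isInjectiveHull_hullMap X
  have hE : injClass (Y n) (injectiveHull X) := (injClass_iff (hgen n)).2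
    ⟨hull.injective_module, fun p hp => absurd (hYn ▸ Set.mem_univ p) hp⟩
  exact evalMap_injective fun x hx =>
    exists_map_cotiltModule_ne_zero D hmono hgen hR hX hE ((map_ne_zero_iff _ hull.mono).2 hx)

theorem leftPerp_cotiltModule_le_cogClass :
    leftPerp (cotiltModule D) ≤ cogClass n (cotiltModule D) :=
  leftPerp_le_cogClass (leftPerp_pow_cotiltModule D hmono hgen hR)
    (fun _ => evalMap_cotiltModule_injective D hmono hgen hR hYn) n

theorem leftPerp_cotiltModule_eq_cogClass :
    leftPerp (cotiltModule D) = cogClass n (cotiltModule D) :=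
  le_antisymm (leftPerp_cotiltModule_le_cogClass D hmono hgen hR hYn)
    ((cogClass_le_extClass D hmono hgen hR hYn).trans (extClass_le_leftPerp D hmono hgen hR))

theorem leftPerp_cotiltModule_eq_cotiltClass : leftPerp (cotiltModule D) = cotiltClass Y := by
  rw [← extClass_eq_cotiltClass hmono hgen]
  refine le_antisymm ?_ (extClass_le_leftPerp D hmono hgen hR)
  exact (leftPerp_cotiltModule_le_cogClass D hmono hgen hR hYn).trans
    (cogClass_le_extClass D hmono hgen hR hYn)

theorem isNCotilting_cotiltModule : IsNCotilting n (cotiltModule D) :=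
  isNCotilting_of_cogenerates (leftPerp_pow_cotiltModule D hmono hgen hR)
    (fun _ => evalMap_cotiltModule_injective D hmono hgen hR hYn)
    (hasInjectiveDimensionLE_cotiltModule D hmono hgen hR hYn)

end Main

end CotiltConstr

theorem theorem4 {R : Type*} [CommRing R] [IsNoetherianRing R]
    (Y : ℕ → Set (PrimeSpectrum R))
    (hmono : Monotone Y)
    (hgen : ∀ i, IsLowerSet (Y i))
    (hass : ∀ (i : ℕ) (p : PrimeSpectrum R),
      p.asIdeal ∈ associatedPrimes R (CotiltConstr.cosyzygy (ModuleCat.of R R) i) → p ∈ Y i)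
    (n : ℕ) (hn : 1 ≤ n) (hYn : Y n = Set.univ) :
    (∃ D : ∀ p, CotiltConstr.PrecoverComplex Y p, ∀ p, (D p).ByCovers) ∧
    ∀ D : ∀ p, CotiltConstr.PrecoverComplex Y p,
      CotiltConstr.leftPerp (CotiltConstr.cotiltModule D) =
        CotiltConstr.cogClass n (CotiltConstr.cotiltModule D) ∧
      CotiltConstr.IsNCotilting n (CotiltConstr.cotiltModule D) ∧
      CotiltConstr.leftPerp (CotiltConstr.cotiltModule D) = CotiltConstr.cotiltClass Y := by
  have hR : CotiltConstr.extClass Y (ModuleCat.of R R) :=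
    (CotiltConstr.extClass_iff_homZero_cosyzygy hmono).2 fun i =>
      CotiltConstr.homZero_of_associatedPrimes (hgen i) (hass i)
  refine ⟨?_, fun D => ⟨?_, ?_, ?_⟩⟩
  · choose D hD using fun p => CotiltConstr.exists_precoverComplex_byCovers (p := p)
      ⟨n, hYn ▸ Set.mem_univ p⟩
    exact ⟨D, hD⟩
  · exact CotiltConstr.leftPerp_cotiltModule_eq_cogClass D hmono hgen hR hYn
  · exact CotiltConstr.isNCotilting_cotiltModule D hmono hgen hR hYn
  · exact CotiltConstr.leftPerp_cotiltModule_eq_cotiltClass D hmono hgen hR hYn
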